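/- Rings are associative with unit. Let $A$ be a ring, let $(\mathcal{C},\Delta,\varepsilon)$ be an $A$-coring (a comonoid in the monoidal category of $A$-bimodules), and let $\mathcal{M}^{\mathcal{C}}$ be the category of right $\mathcal{C}$-comodules and right $\mathcal{C}$-colinear maps. Let $\Sigma\in\mathcal{M}^{\mathcal{C}}$, with coaction $u\mapsto u_{[0]}\otimes_A u_{[1]}$, be finitely generated and projective as a right $A$-module, and put $\Sigma^*=\mathrm{Hom}_A(\Sigma,A)$ (right $A$-linear maps) and $B=\mathrm{End}^{\mathcal{C}}(\Sigma)$. Then $\Sigma$ is a left $B$-module by evaluation, and for every $M\in\mathcal{M}^{\mathcal{C}}$ the group $\mathrm{Hom}^{\mathcal{C}}(\Sigma,M)$ of colinear maps, as well as $\Sigma^*$, is a right $B$-module by composition. Let $G=\mathrm{Hom}^{\mathcal{C}}(\Sigma,-):\mathcal{M}^{\mathcal{C}}\to\mathcal{M}_B$ be the resulting functor to right $B$-modules, and for $M\in\mathcal{M}^{\mathcal{C}}$ let $$\mathrm{ev}_M:\ \mathrm{Hom}^{\mathcal{C}}(\Sigma,M)\otimes_B\Sigma\to M,\qquad \mathrm{ev}_M(f\otimes_B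 u)=f(u).$$ The pair $(\mathcal{C},\Sigma)$ is called Galois if the canonical map $$\mathrm{can}:\ \Sigma^*\otimes_B\Sigma\to\mathcal{C},\qquad \mathrm{can}(g\otimes_B u)=g(u_{[0]})u_{[1]},$$ is an isomorphism, and $\Sigma$ is called a generator of $\mathcal{M}^{\mathcal{C}}$ if for every nonzero $g:M\to N$ in $\mathcal{M}^{\mathcal{C}}$ there is $f\in\mathrm{Hom}^{\mathcal{C}}(\Sigma,M)$ with $g\circ f\neq 0$. The following assertions are equivalent. 1. $(\mathcal{C},\Sigma)$ is Galois and $\Sigma$ is flat as a left $B$-module. 2. $G$ is fully faithful and $\Sigma$ is flat as a left $B$-module. 3. $\Sigma$ is a generator of $\mathcal{M}^{\mathcal{C}}$ and $\mathcal{C}$ is flat as a left $A$-module. 4. $\mathrm{ev}_M$ is bijective for every $M\in\mathcal{M}^{\mathcal{C}}$, and $\Sigma$ is flat as a left $B$-module. -/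

import Mathlib

open CategoryTheory MulOpposite

universe u v w

/-! ### Tensor products over a ring that need not be commutative

Rings are associative with unit. A right module over `A` is a `Module Aᵐᵒᵖ M`, so that
`m a` is written `op a • m`; an `(A, B)`-bimodule carries `Module A M`, `Module Bᵐᵒᵖ M` and
`SMulCommClass A Bᵐᵒᵖ M`. -/

/-- The subgroup of `M ⊗[ℤ] N` generated by all `m a ⊗ n - m ⊗ a n`. -/
def NCTensor.relations (A M N : Type*) [Ring A] [AddCommGroup M] [Module Aᵐᵒᵖ M]
    [AddCommGroup N] [Module A N] : AddSubgroup (TensorProduct ℤ M N) :=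
  AddSubgroup.closure
    {x | ∃ (a : A) (m : M) (n : N),
      x = TensorProduct.tmul ℤ (op a • m) n - TensorProduct.tmul ℤ m (a • n)}

/-- The tensor product over `A` of a right `A`-module `M` and a left `A`-module `N`,
an abelian group. -/
def NCTensor (A M N : Type*) [Ring A] [AddCommGroup M] [Module Aᵐᵒᵖ M]
    [AddCommGroup N] [Module A N] : Type _ :=
  TensorProduct ℤ M N ⧸ NCTensor.relations A M N

namespace NCTensor

noncomputable section

section basic

variable {A M N : Type*} [Ring A] [AddCommGroup M] [Module Aᵐᵒᵖ M] [AddCommGroup N] [Module A N]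

instance : AddCommGroup (NCTensor A M N) :=
  inferInstanceAs (AddCommGroup (TensorProduct ℤ M N ⧸ relations A M N))

/-- The class of `m ⊗ n`. -/
def tmul (A : Type*) {M N : Type*} [Ring A] [AddCommGroup M] [Module Aᵐᵒᵖ M]
    [AddCommGroup N] [Module A N] (m : M) (n : N) : NCTensor A M N :=
  QuotientAddGroup.mk (s := relations A M N) (TensorProduct.tmul ℤ m n)

theorem tmul_add (m : M) (n n' : N) : tmul A m (n + n') = tmul A m n + tmul A m n' := by
  simp only [tmul, TensorProduct.tmul_add]; rfl

theorem add_tmul (m m' : M) (n : N) : tmul A (m + m') n = tmul A m n + tmul A m' n := by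
  simp only [tmul, TensorProduct.add_tmul]; rfl

theorem zero_tmul (n : N) : tmul A (0 : M) n = 0 := by
  simp only [tmul, TensorProduct.zero_tmul]; rfl

theorem tmul_zero (m : M) : tmul A m (0 : N) = 0 := by
  simp only [tmul, TensorProduct.tmul_zero]; rfl

theorem smul_tmul (a : A) (m : M) (n : N) : tmul A (op a • m) n = tmul A m (a • n) := by
  refine QuotientAddGroup.eq.2 ?_
  rw [← neg_mem_iff, neg_add, neg_neg, ← sub_eq_add_neg]
  exact AddSubgroup.subset_closure ⟨a, m, n, rfl⟩

@[elab_as_elim]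
theorem induction_on {P : NCTensor A M N → Prop} (x : NCTensor A M N) (zero : P 0)
    (tmul : ∀ m n, P (tmul A m n)) (add : ∀ x y, P x → P y → P (x + y)) : P x := by
  obtain ⟨y, rfl⟩ := QuotientAddGroup.mk_surjective x
  induction y using TensorProduct.induction_on with
  | zero => exact zero
  | tmul m n => exact tmul m n
  | add y z hy hz => exact add _ _ hy hz

/-- The universal property: a biadditive, `A`-balanced map factors through the tensor product. -/
def lift {P : Type*} [AddCommGroup P] (f : M →+ N →+ P)
    (hf : ∀ (a : A) (m : M) (n : N), f (op a • m) n = f m (a • n)) : NCTensor A M N →+ P :=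
  QuotientAddGroup.lift (relations A M N)
    (TensorProduct.liftAddHom (R := ℤ) f fun r m n => by simp)
    (by
      refine (AddSubgroup.closure_le _).2 ?_
      rintro x ⟨a, m, n, rfl⟩
      simp [AddMonoidHom.mem_ker, hf])

@[simp]
theorem lift_tmul {P : Type*} [AddCommGroup P] (f : M →+ N →+ P)
    (hf : ∀ (a : A) (m : M) (n : N), f (op a • m) n = f m (a • n)) (m : M) (n : N) :
    lift f hf (tmul A m n) = f m n := rfl

theorem hom_ext {P : Type*} [AddCommGroup P] {f g : NCTensor A M N →+ P}
    (h : ∀ m n, f (tmul A m n) = g (tmul A m n)) : f = g := by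
  ext x
  induction x using induction_on with
  | zero => simp
  | tmul m n => exact h m n
  | add x y hx hy => simp [hx, hy]

variable {M' N' : Type*} [AddCommGroup M'] [Module Aᵐᵒᵖ M'] [AddCommGroup N'] [Module A N']

/-- `f ⊗ g`, for `f` right `A`-linear and `g` left `A`-linear. -/
def map (f : M →ₗ[Aᵐᵒᵖ] M') (g : N →ₗ[A] N') : NCTensor A M N →+ NCTensor A M' N' :=
  lift
    { toFun := fun m =>
        { toFun := fun n => tmul A (f m) (g n)
          map_zero' := by simp [tmul_zero]
          map_add' := fun n n' => by simp [tmul_add] }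
      map_zero' := by ext n; simp [zero_tmul]
      map_add' := fun m m' => by ext n; simp [add_tmul] }
    (fun a m n => by simp [smul_tmul])

@[simp]
theorem map_tmul (f : M →ₗ[Aᵐᵒᵖ] M') (g : N →ₗ[A] N') (m : M) (n : N) :
    map f g (tmul A m n) = tmul A (f m) (g n) := rfl

end basic

section actions

variable {A M N : Type*} [Ring A] [AddCommGroup M] [Module Aᵐᵒᵖ M] [AddCommGroup N] [Module A N]

/-- If `N` is an `(A, R)`-bimodule, then `M ⊗ N` is a right `R`-module: `(m ⊗ n) r = m ⊗ n r`. -/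
instance rightModule {R : Type*} [Ring R] [Module Rᵐᵒᵖ N] [SMulCommClass A Rᵐᵒᵖ N] :
    Module Rᵐᵒᵖ (NCTensor A M N) :=
  haveI : SMulCommClass Rᵐᵒᵖ A N := SMulCommClass.symm _ _ _
  Module.compHom (R := AddMonoid.End (NCTensor A M N)) (NCTensor A M N)
    { toFun := fun r => map LinearMap.id (DistribSMul.toLinearMap A N r)
      map_one' := hom_ext fun m n => by simp; rfl
      map_mul' := fun r s => hom_ext fun m n => by simp [mul_smul]; rfl
      map_zero' := hom_ext fun m n => by simp [tmul_zero]; rfl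
      map_add' := fun r s => hom_ext fun m n => by simp [add_smul, tmul_add]; rfl }

@[simp]
theorem op_smul_tmul {R : Type*} [Ring R] [Module Rᵐᵒᵖ N] [SMulCommClass A Rᵐᵒᵖ N]
    (r : Rᵐᵒᵖ) (m : M) (n : N) : r • tmul A m n = tmul A m (r • n) := rfl

/-- If `M` is an `(R, A)`-bimodule, then `M ⊗ N` is a left `R`-module: `r (m ⊗ n) = r m ⊗ n`. -/
instance (priority := low) leftModule {R : Type*} [Ring R] [Module R M] [SMulCommClass R Aᵐᵒᵖ M] :
    Module R (NCTensor A M N) :=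
  Module.compHom (R := AddMonoid.End (NCTensor A M N)) (NCTensor A M N)
    { toFun := fun r => map (DistribSMul.toLinearMap Aᵐᵒᵖ M r) LinearMap.id
      map_one' := hom_ext fun m n => by simp; rfl
      map_mul' := fun r s => hom_ext fun m n => by simp [mul_smul]; rfl
      map_zero' := hom_ext fun m n => by simp [zero_tmul]; rfl
      map_add' := fun r s => hom_ext fun m n => by simp [add_smul, add_tmul]; rfl }

@[simp]
theorem left_smul_tmul {R : Type*} [Ring R] [Module R M] [SMulCommClass R Aᵐᵒᵖ M]
    (r : R) (m : M) (n : N) : r • tmul A m n = tmul A (r • m) n := rfl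

variable (A M) in
/-- The canonical isomorphism `M ⊗ A → M`, `m ⊗ a ↦ m a`. -/
def rid : NCTensor A M A →+ M :=
  lift
    { toFun := fun m =>
        { toFun := fun a => op a • m
          map_zero' := by simp
          map_add' := fun a b => by simp [add_smul] }
      map_zero' := by ext a; simp
      map_add' := fun m m' => by ext a; simp }
    (fun a m b => by simp [mul_smul])

@[simp]
theorem rid_tmul (m : M) (a : A) : rid A M (tmul A m a) = op a • m := rfl

variable (A N) in
/-- The canonical isomorphism `A ⊗ N → N`, `a ⊗ n ↦ a n`. -/
def lid : NCTensor A A N →+ N :=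
  lift
    { toFun := fun a =>
        { toFun := fun n => a • n
          map_zero' := by simp
          map_add' := fun n n' => by simp }
      map_zero' := by ext n; simp
      map_add' := fun a b => by ext n; simp [add_smul] }
    (fun a b n => by simp [mul_smul])

@[simp]
theorem lid_tmul (a : A) (n : N) : lid A N (tmul A a n) = a • n := rfl

end actions

section assoc

variable {A L M N : Type*} [Ring A] [AddCommGroup L] [Module Aᵐᵒᵖ L] [AddCommGroup M]
  [Module A M] [Module Aᵐᵒᵖ M] [SMulCommClass A Aᵐᵒᵖ M] [AddCommGroup N] [Module A N]

variable (A L M N) in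
/-- The map `l ⊗ m ↦ (n ↦ l ⊗ (m ⊗ n))`. -/
def assocAux : NCTensor A L M →+ N →+ NCTensor A L (NCTensor A M N) :=
  lift
    { toFun := fun l =>
        { toFun := fun m =>
            { toFun := fun n => tmul A l (tmul A m n)
              map_zero' := by simp [tmul_zero]
              map_add' := fun n n' => by simp [tmul_add] }
          map_zero' := by ext n; simp [tmul_zero, zero_tmul]
          map_add' := fun m m' => by ext n; simp [add_tmul, tmul_add] }
      map_zero' := by ext m n; simp [zero_tmul]
      map_add' := fun l l' => by ext m n; simp [add_tmul] }
    (fun a l m => by ext n; simp [smul_tmul])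

@[simp]
theorem assocAux_tmul (l : L) (m : M) (n : N) :
    assocAux A L M N (tmul A l m) n = tmul A l (tmul A m n) := rfl

theorem assocAux_balanced (a : A) (x : NCTensor A L M) (n : N) :
    assocAux A L M N (op a • x) n = assocAux A L M N x (a • n) := by
  induction x using induction_on with
  | zero => rw [smul_zero, map_zero]; rfl
  | tmul l m => rw [op_smul_tmul, assocAux_tmul, assocAux_tmul, smul_tmul]
  | add x y hx hy =>
    rw [smul_add, map_add, map_add, AddMonoidHom.add_apply, AddMonoidHom.add_apply, hx, hy]

variable (A L M N) in
/-- The canonical isomorphism `(L ⊗ M) ⊗ N → L ⊗ (M ⊗ N)`, `(l ⊗ m) ⊗ n ↦ l ⊗ (m ⊗ n)`, for `M` an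
`A`-bimodule. -/
def assocHom : NCTensor A (NCTensor A L M) N →+ NCTensor A L (NCTensor A M N) :=
  lift (assocAux A L M N) assocAux_balanced

@[simp]
theorem assocHom_tmul (l : L) (m : M) (n : N) :
    assocHom A L M N (tmul A (tmul A l m) n) = tmul A l (tmul A m n) := rfl

end assoc

end

end NCTensor

/-- A left module `P` over a ring `B` is flat if `- ⊗_B P` preserves injectivity of morphisms of
right `B`-modules. -/
def IsFlatLeft (B P : Type u) [Ring B] [AddCommGroup P] [Module B P] : Prop :=
  ∀ (N N' : Type u) [AddCommGroup N] [Module Bᵐᵒᵖ N] [AddCommGroup N'] [Module Bᵐᵒᵖ N']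
    (f : N →ₗ[Bᵐᵒᵖ] N'), Function.Injective f →
      Function.Injective (NCTensor.map f (LinearMap.id : P →ₗ[B] P))

/-! ### Corings and comodules -/

/-- A morphism of `A`-bimodules. -/
structure BimodHom (A M N : Type*) [Ring A] [AddCommGroup M] [Module A M] [Module Aᵐᵒᵖ M]
    [AddCommGroup N] [Module A N] [Module Aᵐᵒᵖ N] extends M →ₗ[A] N where
  map_op_smul' : ∀ (a : Aᵐᵒᵖ) (m : M), toFun (a • m) = a • toFun m

namespace BimodHom

variable {A M N : Type*} [Ring A] [AddCommGroup M] [Module A M] [Module Aᵐᵒᵖ M]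
  [AddCommGroup N] [Module A N] [Module Aᵐᵒᵖ N]

/-- The underlying left linear map. -/
abbrev left (f : BimodHom A M N) : M →ₗ[A] N := f.toLinearMap

/-- The underlying right linear map. -/
def right (f : BimodHom A M N) : M →ₗ[Aᵐᵒᵖ] N where
  toFun := f.left
  map_add' := f.left.map_add
  map_smul' := f.map_op_smul'

end BimodHom

/-- An `A`-coring structure on the `A`-bimodule `C`: a comonoid structure in the monoidal category
of `A`-bimodules. -/
class Coring (A C : Type*) [Ring A] [AddCommGroup C] [Module A C] [Module Aᵐᵒᵖ C]
    [SMulCommClass A Aᵐᵒᵖ C] where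
  /-- The comultiplication. -/
  comul : BimodHom A C (NCTensor A C C)
  /-- The counit. -/
  counit : BimodHom A C A
  coassoc : ∀ c : C, NCTensor.assocHom A C C C (NCTensor.map comul.right LinearMap.id (comul.left c))
    = NCTensor.map LinearMap.id comul.left (comul.left c)
  counit_comul : ∀ c : C,
    NCTensor.lid A C (NCTensor.map counit.right LinearMap.id (comul.left c)) = c
  comul_counit : ∀ c : C,
    NCTensor.rid A C (NCTensor.map LinearMap.id counit.left (comul.left c)) = c

/-- A right `C`-comodule structure on the right `A`-module `M`. -/
class RightComodule (A C M : Type*) [Ring A] [AddCommGroup C] [Module A C] [Module Aᵐᵒᵖ C]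
    [SMulCommClass A Aᵐᵒᵖ C] [Coring A C] [AddCommGroup M] [Module Aᵐᵒᵖ M] where
  /-- The coaction. -/
  coact : M →ₗ[Aᵐᵒᵖ] NCTensor A M C
  coassoc : ∀ m : M, NCTensor.assocHom A M C C (NCTensor.map coact LinearMap.id (coact m))
    = NCTensor.map LinearMap.id (Coring.comul (A := A) (C := C)).left (coact m)
  counit_coact : ∀ m : M,
    NCTensor.rid A M (NCTensor.map LinearMap.id (Coring.counit (A := A) (C := C)).left (coact m)) = m

/-- The type of right `C`-comodules. -/
structure ComoduleCat (A C : Type u) [Ring A] [AddCommGroup C] [Module A C] [Module Aᵐᵒᵖ C]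
    [SMulCommClass A Aᵐᵒᵖ C] [Coring A C] where
  /-- The underlying type. -/
  carrier : Type u
  [addCommGroup : AddCommGroup carrier]
  [module : Module Aᵐᵒᵖ carrier]
  [comodule : RightComodule A C carrier]

namespace ComoduleCat

noncomputable section

variable {A C : Type u} [Ring A] [AddCommGroup C] [Module A C] [Module Aᵐᵒᵖ C]
  [SMulCommClass A Aᵐᵒᵖ C] [Coring A C]

instance : CoeSort (ComoduleCat A C) (Type u) := ⟨carrier⟩

attribute [instance] addCommGroup module comodule

/-- The coaction `M → M ⊗_A C`. -/
def coact (M : ComoduleCat A C) : M →ₗ[Aᵐᵒᵖ] NCTensor A M C :=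
  RightComodule.coact

/-- The group `Hom^C(M, N)` of right `C`-colinear maps: right `A`-linear maps `f` with
`ρ_N ∘ f = (f ⊗ C) ∘ ρ_M`. -/
def colinear (M N : ComoduleCat A C) : AddSubgroup (M →ₗ[Aᵐᵒᵖ] N) where
  carrier := {f | ∀ m : M, N.coact (f m) = NCTensor.map f LinearMap.id (M.coact m)}
  zero_mem' := fun m => by
    have h : NCTensor.map (0 : M →ₗ[Aᵐᵒᵖ] N) (LinearMap.id : C →ₗ[A] C) = 0 :=
      NCTensor.hom_ext fun m c => by simp [NCTensor.zero_tmul]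
    simp [h]
  add_mem' := fun {f g} hf hg m => by
    have h : NCTensor.map (f + g) (LinearMap.id : C →ₗ[A] C)
        = NCTensor.map f LinearMap.id + NCTensor.map g LinearMap.id :=
      NCTensor.hom_ext fun m c => by simp [NCTensor.add_tmul]
    simp only [LinearMap.add_apply, map_add, h, AddMonoidHom.add_apply]
    rw [hf m, hg m]
  neg_mem' := fun {f} hf m => by
    have h : NCTensor.map (-f) (LinearMap.id : C →ₗ[A] C) = -NCTensor.map f LinearMap.id :=
      NCTensor.hom_ext fun m c => by
        rw [AddMonoidHom.neg_apply, eq_neg_iff_add_eq_zero]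
        simp [← NCTensor.add_tmul, NCTensor.zero_tmul]
    simp only [LinearMap.neg_apply, map_neg, h, AddMonoidHom.neg_apply]
    rw [hf m]

/-- The category of right `C`-comodules and right `C`-colinear maps. -/
instance : Category.{u} (ComoduleCat A C) where
  Hom M N := colinear M N
  id M := ⟨LinearMap.id, fun m => by
    have h : NCTensor.map (LinearMap.id : M →ₗ[Aᵐᵒᵖ] M) (LinearMap.id : C →ₗ[A] C)
        = AddMonoidHom.id _ := NCTensor.hom_ext fun m c => by simp
    simp [h]⟩
  comp {M N P} f g := ⟨g.1.comp f.1, fun m => by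
    have h : NCTensor.map (g.1.comp f.1) (LinearMap.id : C →ₗ[A] C)
        = (NCTensor.map g.1 LinearMap.id).comp (NCTensor.map f.1 LinearMap.id) :=
      NCTensor.hom_ext fun m c => by simp
    rw [h, LinearMap.comp_apply, g.2, f.2, AddMonoidHom.comp_apply]⟩

/-- The colinear map underlying a morphism. -/
def Hom.lin {M N : ComoduleCat A C} (f : M ⟶ N) : M →ₗ[Aᵐᵒᵖ] N :=
  Subtype.val (p := fun g => g ∈ colinear M N) f

instance (M N : ComoduleCat A C) : AddCommGroup (M ⟶ N) :=
  inferInstanceAs (AddCommGroup (colinear M N))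

@[simp]
theorem lin_id (M : ComoduleCat A C) : Hom.lin (𝟙 M) = LinearMap.id := rfl

@[simp]
theorem lin_comp {M N P : ComoduleCat A C} (f : M ⟶ N) (g : N ⟶ P) :
    Hom.lin (f ≫ g) = (Hom.lin g).comp (Hom.lin f) := rfl

@[simp]
theorem lin_zero (M N : ComoduleCat A C) : Hom.lin (0 : M ⟶ N) = 0 := rfl

@[simp]
theorem lin_add {M N : ComoduleCat A C} (f g : M ⟶ N) :
    Hom.lin (f + g) = Hom.lin f + Hom.lin g := rfl

theorem lin_colinear {M N : ComoduleCat A C} (f : M ⟶ N) (m : M) :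
    N.coact (Hom.lin f m) = NCTensor.map (Hom.lin f) LinearMap.id (M.coact m) := f.2 m

theorem hom_ext {M N : ComoduleCat A C} {f g : M ⟶ N}
    (h : ∀ m, Hom.lin f m = Hom.lin g m) : f = g :=
  Subtype.ext (LinearMap.ext h)

instance : Preadditive (ComoduleCat A C) where
  add_comp M N P f g h := hom_ext fun m => by simp
  comp_add M N P f g h := hom_ext fun m => by simp

variable (S : ComoduleCat A C)

/-- `S` is a left module over `T = End^C(S)`, whose multiplication is composition `f ∘ g`. -/
instance : Module (End S) S where
  smul f u := Hom.lin f u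
  one_smul _ := rfl
  mul_smul _ _ _ := rfl
  smul_zero f := (Hom.lin f).map_zero
  smul_add f := (Hom.lin f).map_add
  add_smul _ _ _ := rfl
  zero_smul _ := rfl

theorem end_smul_def (f : End S) (u : S) : f • u = Hom.lin f u := rfl

instance : SMulCommClass (End S) Aᵐᵒᵖ S where
  smul_comm f a u := (Hom.lin f).map_smul a u

/-- The right dual `S* = Hom_A(S, A)`. It is a left `A`-module by `(a g)(u) = a g(u)`. -/
abbrev Dual : Type u := S →ₗ[Aᵐᵒᵖ] A

/-- `S*` is a right module over `T = End^C(S)`: `(g f)(u) = g(f(u))`. -/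
instance : Module (End S)ᵐᵒᵖ (Dual S) where
  smul f g := g.comp (Hom.lin f.unop)
  one_smul _ := rfl
  mul_smul _ _ _ := rfl
  smul_zero _ := rfl
  smul_add _ _ _ := rfl
  add_smul f f' g := LinearMap.ext fun u => g.map_add (Hom.lin f.unop u) (Hom.lin f'.unop u)
  zero_smul g := LinearMap.ext fun _ => g.map_zero

theorem op_end_smul_dual (f : (End S)ᵐᵒᵖ) (g : Dual S) (u : S) :
    (f • g) u = g (Hom.lin f.unop u) := rfl

instance : SMulCommClass A (End S)ᵐᵒᵖ (Dual S) where
  smul_comm _ _ _ := rfl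

/-- For fixed `g` in `S*`, the map `S → C`, `u ↦ g(u_[0]) u_[1]`. -/
def canAux (g : Dual S) : S →+ C :=
  (NCTensor.lid A C).comp
    ((NCTensor.map g (LinearMap.id : C →ₗ[A] C)).comp S.coact.toAddMonoidHom)

theorem canAux_apply (g : Dual S) (u : S) :
    canAux S g u = NCTensor.lid A C (NCTensor.map g LinearMap.id (S.coact u)) := rfl

theorem canAux_add (g h : Dual S) : canAux S (g + h) = canAux S g + canAux S h := by
  ext u
  simp only [canAux_apply, AddMonoidHom.add_apply]
  generalize S.coact u = x
  induction x using NCTensor.induction_on with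
  | zero => simp
  | tmul m c => simp [add_smul]
  | add x y hx hy => simp only [map_add, hx, hy]; abel

theorem canAux_smul (a : A) (g : Dual S) (u : S) : canAux S (a • g) u = a • canAux S g u := by
  simp only [canAux_apply]
  generalize S.coact u = x
  induction x using NCTensor.induction_on with
  | zero => simp
  | tmul m c => simp [mul_smul]
  | add x y hx hy => simp only [map_add, smul_add, hx, hy]

theorem canAux_op_smul (a : Aᵐᵒᵖ) (g : Dual S) (u : S) : canAux S g (a • u) = a • canAux S g u := by
  simp only [canAux_apply, map_smul]
  generalize S.coact u = x
  induction x using NCTensor.induction_on with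
  | zero => simp
  | tmul m c => simp [smul_comm]
  | add x y hx hy => simp only [map_add, smul_add, hx, hy]

theorem canAux_balanced (f : End S) (g : Dual S) (u : S) :
    canAux S (op f • g) u = canAux S g (f • u) := by
  simp only [canAux_apply, end_smul_def, lin_colinear]
  generalize S.coact u = x
  induction x using NCTensor.induction_on with
  | zero => simp
  | tmul m c => simp [op_end_smul_dual]
  | add x y hx hy => simp only [map_add, hx, hy]

/-- The map `S* ⊗_T S → C`, `g ⊗ u ↦ g(u_[0]) u_[1]`. -/
def canHom : NCTensor (End S) (Dual S) S →+ C :=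
  NCTensor.lift (AddMonoidHom.mk' (canAux S) (canAux_add S)) (canAux_balanced S)

@[simp]
theorem canHom_tmul (g : Dual S) (u : S) :
    canHom S (NCTensor.tmul (End S) g u) = canAux S g u := rfl

/-- The canonical map `can : S* ⊗_T S → C`, `g ⊗ u ↦ g(u_[0]) u_[1]`, as a morphism of
`A`-bimodules; here `T = End^C(S)`, and `S* ⊗_T S` is the bimodule underlying the comatrix
coring. -/
def can : BimodHom A (NCTensor (End S) (Dual S) S) C where
  toFun := canHom S
  map_add' := (canHom S).map_add
  map_smul' a x := by
    induction x using NCTensor.induction_on with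
    | zero => simp
    | tmul g u => simp [canAux_smul]
    | add x y hx hy => simp only [RingHom.id_apply, map_add, smul_add] at *; rw [hx, hy]
  map_op_smul' a x := by
    induction x using NCTensor.induction_on with
    | zero => simp
    | tmul g u => simp [canAux_op_smul]
    | add x y hx hy => simp only [map_add, smul_add] at *; rw [hx, hy]

/-- `(C, S)` is Galois: `can` is an isomorphism. As `can` is always a morphism of corings for the
comatrix coring structure on `S* ⊗_T S`, it is an isomorphism exactly when it is bijective. -/
def IsGalois : Prop :=
  Function.Bijective (can S).left

/-- The evaluation map `ev_M : Hom^C(S, M) ⊗_T S → M`, `f ⊗ u ↦ f(u)`, where the right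
`T`-module structure on `Hom^C(S, M)` is given by composition. -/
def ev (M : ComoduleCat A C) : NCTensor (End S) (S ⟶ M) S →+ M :=
  NCTensor.lift
    (AddMonoidHom.mk' (fun f : S ⟶ M => (Hom.lin f).toAddMonoidHom) fun _ _ => rfl)
    (fun _ _ _ => rfl)

@[simp]
theorem ev_tmul (M : ComoduleCat A C) (f : S ⟶ M) (u : S) :
    ev S M (NCTensor.tmul (End S) f u) = Hom.lin f u := rfl

/-- `S` generates the category of right `C`-comodules: for every nonzero `g : M ⟶ N` there is
`f : S ⟶ M` with `g ∘ f` nonzero. -/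
def IsGenerator : Prop :=
  ∀ (M N : ComoduleCat A C) (g : M ⟶ N), g ≠ 0 → ∃ f : S ⟶ M, f ≫ g ≠ 0

/-- The functor `G = Hom^C(S, -)` from right `C`-comodules to right `T`-modules. -/
abbrev homFunctor : ComoduleCat A C ⥤ ModuleCat.{u} (End S)ᵐᵒᵖ :=
  preadditiveCoyonedaObj S

end

end ComoduleCat

/-! Write T = End^C(S). The functor - ⊗_T S is left adjoint to Hom^C(S, -) with counit `ev`, so
assertion 4 is the hub. The right adjoint is fully faithful exactly when the counit is invertible,
which is 2 ⇔ 4.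

Galois side. Composing with the counit of C gives Hom^C(S, C) ≅ S*, and `can` is `ev` at C under
this identification, so 4 gives 1. Conversely, as S is finitely generated projective over A,
bijectivity of `can` spreads to every right A-module X: the map `linCoact` from Hom_A(S, X) ⊗_T S to
X ⊗_A C is bijective (`IsGalois.linCoact_bijective`). Now Hom^C(S, M) is the kernel of the defect of
colinearity on Hom_A(S, M), and M is the kernel of the difference of ρ ⊗ C and M ⊗ Δ on M ⊗_A C.
Since S is flat over T, the first kernel survives - ⊗_T S, and `linCoact` matches it with the
second, so `ev` is bijective (`IsGalois.ev_bijective`). The same isomorphism turns flatness of S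
over T into flatness of C over A.

Generator side. Surjectivity of every `ev` makes S a generator; conversely a generator maps to zero
in no nonzero quotient of M by the image of `ev`. If C is flat, kernels of colinear maps are
comodules, and an argument in the style of Gabriel and Popescu shows that an injective N → Hom^C(S,
M) induces an injective N ⊗_T S → M (`IsGenerator.tensorDescLin_injective`). With N = Hom^C(S, M)
this is injectivity of `ev`; with N a right ideal of T it is the ideal criterion for flatness of S,
which is proved with character modules. -/

namespace NCTensor

noncomputable section

/-! ### Functoriality and associativity of the tensor product -/

section functoriality

variable {A M N M' N' M'' N'' : Type*} [Ring A] [AddCommGroup M] [Module Aᵐᵒᵖ M]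
  [AddCommGroup N] [Module A N] [AddCommGroup M'] [Module Aᵐᵒᵖ M'] [AddCommGroup N'] [Module A N']
  [AddCommGroup M''] [Module Aᵐᵒᵖ M''] [AddCommGroup N''] [Module A N'']

theorem map_map (f : M →ₗ[Aᵐᵒᵖ] M') (g : N →ₗ[A] N') (f' : M' →ₗ[Aᵐᵒᵖ] M'') (g' : N' →ₗ[A] N'')
    (x : NCTensor A M N) : map f' g' (map f g x) = map (f' ∘ₗ f) (g' ∘ₗ g) x :=
  DFunLike.congr_fun (hom_ext (f := (map f' g').comp (map f g))
    (g := map (f' ∘ₗ f) (g' ∘ₗ g)) fun _ _ => rfl) x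

theorem map_id_id (x : NCTensor A M N) :
    map (LinearMap.id : M →ₗ[Aᵐᵒᵖ] M) (LinearMap.id : N →ₗ[A] N) x = x :=
  DFunLike.congr_fun (hom_ext (f := map LinearMap.id LinearMap.id) (g := AddMonoidHom.id _)
    fun _ _ => rfl) x

theorem map_zero_left (g : N →ₗ[A] N') (x : NCTensor A M N) :
    map (0 : M →ₗ[Aᵐᵒᵖ] M') g x = 0 :=
  DFunLike.congr_fun (hom_ext (g := 0) fun m n => by simp [zero_tmul]) x

theorem map_sub_left (f f' : M →ₗ[Aᵐᵒᵖ] M') (g : N →ₗ[A] N') (x : NCTensor A M N) :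
    map (f - f') g x = map f g x - map f' g x := by
  rw [eq_sub_iff_add_eq, ← AddMonoidHom.add_apply]
  exact DFunLike.congr_fun (hom_ext fun m n => by simp [← add_tmul]) x

theorem map_surjective {f : M →ₗ[Aᵐᵒᵖ] M'} (hf : Function.Surjective f) :
    Function.Surjective (map f (LinearMap.id : N →ₗ[A] N)) := by
  intro x
  induction x using induction_on with
  | zero => exact ⟨0, map_zero _⟩
  | tmul m n => obtain ⟨m, rfl⟩ := hf m; exact ⟨tmul A m n, rfl⟩
  | add x y hx hy =>
    obtain ⟨x, rfl⟩ := hx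
    obtain ⟨y, rfl⟩ := hy
    exact ⟨x + y, map_add _ _ _⟩

theorem map_bijective {f : M →ₗ[Aᵐᵒᵖ] M'} (hf : Function.Bijective f) :
    Function.Bijective (map f (LinearMap.id : N →ₗ[A] N)) := by
  refine ⟨Function.LeftInverse.injective
    (g := map (LinearEquiv.ofBijective f hf).symm.toLinearMap LinearMap.id) fun x => ?_,
    map_surjective hf.2⟩
  rw [map_map, LinearMap.comp_id]
  convert map_id_id x using 3
  ext m
  exact (LinearEquiv.ofBijective f hf).symm_apply_apply m

theorem map_id_bijective {g : N →ₗ[A] N'} (hg : Function.Bijective g) :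
    Function.Bijective (map (LinearMap.id : M →ₗ[Aᵐᵒᵖ] M) g) := by
  set e := LinearEquiv.ofBijective g hg
  have h1 : e.symm.toLinearMap ∘ₗ g = LinearMap.id := LinearMap.ext e.symm_apply_apply
  have h2 : g ∘ₗ e.symm.toLinearMap = LinearMap.id := LinearMap.ext e.apply_symm_apply
  refine ⟨Function.LeftInverse.injective (g := map LinearMap.id e.symm.toLinearMap) fun x => ?_,
    Function.RightInverse.surjective (g := map LinearMap.id e.symm.toLinearMap) fun x => ?_⟩
  · rw [map_map, h1, LinearMap.comp_id, map_id_id]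
  · rw [map_map, h2, LinearMap.comp_id, map_id_id]

theorem sum_tmul {ι : Type*} (s : Finset ι) (m : ι → M) (n : N) :
    tmul A (∑ i ∈ s, m i) n = ∑ i ∈ s, tmul A (m i) n :=
  map_sum (AddMonoidHom.mk' (fun m => tmul A m n) fun m m' => add_tmul m m' n) m s

theorem exists_fin_sum (x : NCTensor A M N) :
    ∃ (k : ℕ) (m : Fin k → M) (n : Fin k → N), x = ∑ i, tmul A (m i) (n i) := by
  induction x using induction_on with
  | zero => exact ⟨0, Fin.elim0, Fin.elim0, by simp⟩
  | tmul m n => exact ⟨1, fun _ => m, fun _ => n, by simp⟩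
  | add x y hx hy =>
    obtain ⟨k, m, n, rfl⟩ := hx
    obtain ⟨l, m', n', rfl⟩ := hy
    exact ⟨k + l, Fin.append m m', Fin.append n n', by simp [Fin.sum_univ_add]⟩

/-- `f ⊗ id` as a morphism of right modules. -/
def mapRight {R : Type*} [Ring R] [Module Rᵐᵒᵖ N] [SMulCommClass A Rᵐᵒᵖ N]
    (f : M →ₗ[Aᵐᵒᵖ] M') : NCTensor A M N →ₗ[Rᵐᵒᵖ] NCTensor A M' N where
  toFun := map f LinearMap.id
  map_add' := map_add _
  map_smul' r x := by
    induction x using induction_on with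
    | zero => simp
    | tmul m n => simp
    | add x y hx hy => simp only [RingHom.id_apply, map_add, smul_add] at *; rw [hx, hy]

@[simp]
theorem mapRight_apply {R : Type*} [Ring R] [Module Rᵐᵒᵖ N] [SMulCommClass A Rᵐᵒᵖ N]
    (f : M →ₗ[Aᵐᵒᵖ] M') (x : NCTensor A M N) :
    mapRight (R := R) f x = map f LinearMap.id x := rfl

variable (N) in
/-- `m ⊗ -` as a morphism of right modules. -/
def mkRight {R : Type*} [Ring R] [Module Rᵐᵒᵖ N] [SMulCommClass A Rᵐᵒᵖ N] (m : M) :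
    N →ₗ[Rᵐᵒᵖ] NCTensor A M N where
  toFun := tmul A m
  map_add' := tmul_add m
  map_smul' _ _ := rfl

@[simp]
theorem mkRight_apply {R : Type*} [Ring R] [Module Rᵐᵒᵖ N] [SMulCommClass A Rᵐᵒᵖ N] (m : M)
    (n : N) : mkRight (R := R) N m n = tmul A m n := rfl

end functoriality

section assoc

variable {A L M N : Type*} [Ring A] [AddCommGroup L] [Module Aᵐᵒᵖ L] [AddCommGroup M]
  [Module A M] [Module Aᵐᵒᵖ M] [SMulCommClass A Aᵐᵒᵖ M] [AddCommGroup N] [Module A N]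

variable (A M N) in
/-- The map `m ⊗ n ↦ (l ⊗ m) ⊗ n` for fixed `l`. -/
def assocInvAux (l : L) : NCTensor A M N →+ NCTensor A (NCTensor A L M) N :=
  map (mkRight M l) LinearMap.id

@[simp]
theorem assocInvAux_tmul (l : L) (m : M) (n : N) :
    assocInvAux A M N l (tmul A m n) = tmul A (tmul A l m) n := rfl

variable (A L M N) in
/-- The inverse `l ⊗ (m ⊗ n) ↦ (l ⊗ m) ⊗ n` of the associativity isomorphism. -/
def assocInv : NCTensor A L (NCTensor A M N) →+ NCTensor A (NCTensor A L M) N :=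
  lift
    (AddMonoidHom.mk' (assocInvAux A M N) fun l l' => hom_ext fun m n => by simp [add_tmul])
    (fun a l x => by
      induction x using induction_on with
      | zero => simp
      | tmul m n => simp [smul_tmul]
      | add x y hx hy => rw [smul_add, map_add, map_add, hx, hy])

@[simp]
theorem assocInv_tmul (l : L) (m : M) (n : N) :
    assocInv A L M N (tmul A l (tmul A m n)) = tmul A (tmul A l m) n := rfl

theorem assocInv_assocHom (x : NCTensor A (NCTensor A L M) N) :
    assocInv A L M N (assocHom A L M N x) = x := by
  induction x using induction_on with
  | zero => simp
  | tmul y n =>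
    induction y using induction_on with
    | zero => simp [zero_tmul]
    | tmul l m => simp
    | add x y hx hy => simp only [add_tmul, map_add, hx, hy]
  | add x y hx hy => simp only [map_add, hx, hy]

theorem assocHom_assocInv (x : NCTensor A L (NCTensor A M N)) :
    assocHom A L M N (assocInv A L M N x) = x := by
  induction x using induction_on with
  | zero => simp
  | tmul l y =>
    induction y using induction_on with
    | zero => simp [tmul_zero]
    | tmul m n => simp
    | add x y hx hy => simp only [tmul_add, map_add, hx, hy]
  | add x y hx hy => simp only [map_add, hx, hy]

theorem assocHom_injective : Function.Injective (assocHom A L M N) :=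
  Function.LeftInverse.injective assocInv_assocHom

theorem assocHom_surjective : Function.Surjective (assocHom A L M N) :=
  Function.RightInverse.surjective assocHom_assocInv

theorem assocHom_map {L' : Type*} [AddCommGroup L'] [Module Aᵐᵒᵖ L'] (f : L →ₗ[Aᵐᵒᵖ] L')
    (x : NCTensor A (NCTensor A L M) N) :
    assocHom A L' M N (map (mapRight f) LinearMap.id x) =
      map f LinearMap.id (assocHom A L M N x) := by
  induction x using induction_on with
  | zero => simp
  | tmul y n =>
    induction y using induction_on with
    | zero => simp [zero_tmul]
    | tmul l m => simp
    | add x y hx hy => simp only [add_tmul, map_add, hx, hy]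
  | add x y hx hy => simp only [map_add, hx, hy]

theorem rid_map {L' : Type*} [AddCommGroup L'] [Module Aᵐᵒᵖ L'] (f : L →ₗ[Aᵐᵒᵖ] L')
    (x : NCTensor A L A) : rid A L' (map f LinearMap.id x) = f (rid A L x) := by
  induction x using induction_on with
  | zero => simp
  | tmul l a => simp
  | add x y hx hy => simp only [map_add, hx, hy]

theorem lid_map {N' : Type*} [AddCommGroup N'] [Module A N'] (g : N →ₗ[A] N')
    (x : NCTensor A A N) : lid A N' (map LinearMap.id g x) = g (lid A N x) := by
  induction x using induction_on with
  | zero => simp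
  | tmul l a => simp
  | add x y hx hy => simp only [map_add, hx, hy]

end assoc

/-! ### Right exactness, and flatness tested on ideals -/

section exactness

variable {B L P : Type*} [Ring B] [AddCommGroup L] [Module Bᵐᵒᵖ L] [AddCommGroup P] [Module B P]

/-- Right exactness of `- ⊗ P`: the kernel of `L ⊗ P → (L / K) ⊗ P` is the image of `K ⊗ P`. -/
theorem exists_map_subtype_of_map_mkQ_eq_zero (K : Submodule Bᵐᵒᵖ L) {x : NCTensor B L P}
    (hx : map K.mkQ (LinearMap.id : P →ₗ[B] P) x = 0) :
    ∃ y, map K.subtype (LinearMap.id : P →ₗ[B] P) y = x := by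
  -- The quotient map L ⊗ P → (L ⊗ P) / R will be factored through (L / K) ⊗ P: this is possible
  -- because l ⊗ p lies in R for l in K. An element that dies in (L / K) ⊗ P then lies in R.
  set R := (map K.subtype (LinearMap.id : P →ₗ[B] P)).range
  let F : L →+ P →+ NCTensor B L P ⧸ R :=
    AddMonoidHom.mk' (fun l => (QuotientAddGroup.mk' R).comp
      (AddMonoidHom.mk' (fun p => tmul B l p) (tmul_add l)))
      fun l l' => by ext p; simp [add_tmul]
  have hF : ∀ l p, F l p = QuotientAddGroup.mk' R (tmul B l p) := fun _ _ => rfl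
  let G : L ⧸ K →+ P →+ NCTensor B L P ⧸ R :=
    AddMonoidHom.liftOfSurjective K.mkQ.toAddMonoidHom K.mkQ_surjective
      ⟨F, fun l hl => by
        have hl' : l ∈ K := by simpa using hl
        rw [AddMonoidHom.mem_ker]
        ext p
        rw [hF]
        exact (QuotientAddGroup.eq_zero_iff _).2 ⟨tmul B ⟨l, hl'⟩ p, rfl⟩⟩
  have hG : ∀ l, G (K.mkQ l) = F l := fun l =>
    AddMonoidHom.liftOfRightInverse_comp_apply _ _ _ _ l
  let H : NCTensor B (L ⧸ K) P →+ NCTensor B L P ⧸ R := lift G fun b l p => by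
    obtain ⟨l, rfl⟩ := K.mkQ_surjective l
    rw [← map_smul, hG, hG, hF, hF, smul_tmul]
  have hH : H.comp (map K.mkQ (LinearMap.id : P →ₗ[B] P)) = QuotientAddGroup.mk' R :=
    hom_ext fun l p => by
      rw [← hF, ← hG]; rfl
  have h0 : QuotientAddGroup.mk' R x = 0 := by
    rw [← hH, AddMonoidHom.comp_apply, hx, map_zero]
  exact (QuotientAddGroup.eq_zero_iff _).1 h0

end exactness

section flat

variable {B P : Type u} [Ring B] [AddCommGroup P] [Module B P]

/-- Factor f as L → L / ker f → L'. The second map is injective, so flatness moves the vanishing to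
(L / ker f) ⊗ P, where right exactness applies. -/
theorem exists_map_ker_subtype_of_flat (hP : IsFlatLeft B P) {L L' : Type u} [AddCommGroup L]
    [Module Bᵐᵒᵖ L] [AddCommGroup L'] [Module Bᵐᵒᵖ L'] (f : L →ₗ[Bᵐᵒᵖ] L') {x : NCTensor B L P}
    (hx : map f (LinearMap.id : P →ₗ[B] P) x = 0) :
    ∃ y, map (LinearMap.ker f).subtype (LinearMap.id : P →ₗ[B] P) y = x := by
  apply exists_map_subtype_of_map_mkQ_eq_zero
  apply hP _ _ ((LinearMap.ker f).liftQ f le_rfl)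
    (LinearMap.ker_eq_bot.1 (Submodule.ker_liftQ_eq_bot _ _ _ le_rfl))
  rw [map_map, map_zero, LinearMap.comp_id]
  convert hx using 3
  exact Submodule.liftQ_mkQ _ _ _

/-- The characters of a left `B`-module, which form a right `B`-module. -/
def RightCharacter (P : Type u) [AddCommGroup P] : Type u := CharacterModule P

instance : AddCommGroup (RightCharacter P) := inferInstanceAs (AddCommGroup (CharacterModule P))

instance : FunLike (RightCharacter P) P (AddCircle (1 : ℚ)) :=
  inferInstanceAs (FunLike (CharacterModule P) P (AddCircle (1 : ℚ)))

instance : AddMonoidHomClass (RightCharacter P) P (AddCircle (1 : ℚ)) where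
  map_add := AddMonoidHom.map_add (M := P) (N := AddCircle (1 : ℚ))
  map_zero := AddMonoidHom.map_zero (M := P) (N := AddCircle (1 : ℚ))

theorem RightCharacter.ext {χ ψ : RightCharacter P} (h : ∀ p, χ p = ψ p) : χ = ψ :=
  DFunLike.ext _ _ h

theorem RightCharacter.add_apply (χ ψ : RightCharacter P) (p : P) : (χ + ψ) p = χ p + ψ p := rfl

/-- The action `(χ b)(p) = χ (b p)`. -/
instance : Module Bᵐᵒᵖ (RightCharacter P) where
  smul b χ := AddMonoidHom.mk' (fun p => χ (b.unop • p)) fun p q => by rw [smul_add, map_add]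
  one_smul χ := RightCharacter.ext fun p => congrArg χ (one_smul B p)
  mul_smul b c χ := RightCharacter.ext fun p => congrArg χ (mul_smul c.unop b.unop p)
  smul_zero b := rfl
  smul_add b χ ψ := rfl
  add_smul b c χ := RightCharacter.ext fun p =>
    (congrArg χ (add_smul b.unop c.unop p)).trans (map_add χ _ _)
  zero_smul χ := RightCharacter.ext fun p => (congrArg χ (zero_smul B p)).trans (map_zero χ)

theorem RightCharacter.smul_apply (b : Bᵐᵒᵖ) (χ : RightCharacter P) (p : P) :
    (b • χ) p = χ (b.unop • p) := rfl

/-- A morphism into the character module is a character of the tensor product. -/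
def characterUncurry {N : Type*} [AddCommGroup N] [Module Bᵐᵒᵖ N]
    (f : N →ₗ[Bᵐᵒᵖ] RightCharacter P) : NCTensor B N P →+ AddCircle (1 : ℚ) :=
  lift (AddMonoidHom.mk' (fun n => AddMonoidHom.mk' (fun p => f n p) (map_add (f n)))
    fun n n' => by ext p; simp [RightCharacter.add_apply])
    fun b n p => by simp [RightCharacter.smul_apply]

@[simp]
theorem characterUncurry_tmul {N : Type*} [AddCommGroup N] [Module Bᵐᵒᵖ N]
    (f : N →ₗ[Bᵐᵒᵖ] RightCharacter P) (n : N) (p : P) :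
    characterUncurry f (tmul B n p) = f n p := rfl

/-- A character of the tensor product gives a morphism into the character module. -/
def characterCurry {N : Type*} [AddCommGroup N] [Module Bᵐᵒᵖ N]
    (χ : NCTensor B N P →+ AddCircle (1 : ℚ)) : N →ₗ[Bᵐᵒᵖ] RightCharacter P where
  toFun n := AddMonoidHom.mk' (fun p => χ (tmul B n p)) fun p q => by rw [tmul_add, map_add]
  map_add' n n' := RightCharacter.ext fun p =>
    (congrArg χ (add_tmul n n' p)).trans (map_add χ _ _)
  map_smul' b n := RightCharacter.ext fun p => congrArg χ (smul_tmul b.unop n p)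

variable (P) in
/-- The multiplication map `I ⊗ P → P`, `b ⊗ p ↦ b p`, for a right ideal `I`. -/
def idealMul (I : Ideal Bᵐᵒᵖ) : NCTensor B I P →+ P :=
  lift (AddMonoidHom.mk' (fun b => DistribSMul.toAddMonoidHom P b.1.unop)
    fun b c => by ext p; simp [add_smul]) fun b c p => by simp [mul_smul]

@[simp]
theorem idealMul_tmul (I : Ideal Bᵐᵒᵖ) (b : I) (p : P) :
    idealMul P I (tmul B b p) = b.1.unop • p := rfl

/-- A left module is flat if `I ⊗ P → P` is injective for all right ideals `I`. -/
theorem isFlatLeft_of_idealMul_injective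
    (h : ∀ I : Ideal Bᵐᵒᵖ, Function.Injective (idealMul P I)) : IsFlatLeft B P := by
  -- Baer's criterion for the character module: a morphism from I into it is a character of I ⊗ P.
  -- As I ⊗ P → P is injective and ℚ/ℤ is divisible, this character extends to some χ on P, and b ↦
  -- χ b is the required extension.
  have hB : Module.Baer Bᵐᵒᵖ (RightCharacter P) := by
    intro I g
    obtain ⟨χ, hχ⟩ := (Module.Baer.of_divisible (AddCircle (1 : ℚ))).extension_property_addMonoidHom
      (idealMul P I) (h I) (characterUncurry g)
    refine ⟨LinearMap.toSpanSingleton Bᵐᵒᵖ (RightCharacter P) χ, fun b hb => ?_⟩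
    refine RightCharacter.ext fun p => ?_
    have hp := DFunLike.congr_fun hχ (tmul B (⟨b, hb⟩ : I) p)
    rwa [AddMonoidHom.comp_apply, idealMul_tmul, characterUncurry_tmul] at hp
  intro N N' _ _ _ _ f hf
  rw [injective_iff_map_eq_zero]
  intro x hx
  by_contra hne
  obtain ⟨χ, hχ⟩ := CharacterModule.exists_character_apply_ne_zero_of_ne_zero hne
  -- A character of N ⊗ P is a morphism from N to the character module, which extends along f by
  -- injectivity. Hence χ factors through f ⊗ P and vanishes at x, against its choice.
  obtain ⟨ψ, hψ⟩ := hB.extension_property f hf (characterCurry χ)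
  have h2 : (characterUncurry ψ).comp (map f LinearMap.id) = χ := hom_ext fun n p =>
    DFunLike.congr_fun (DFunLike.congr_fun hψ n) p
  apply hχ
  have := DFunLike.congr_fun h2 x
  rw [AddMonoidHom.comp_apply, hx, map_zero] at this
  exact this.symm

end flat

end

end NCTensor

namespace ComoduleCat

open NCTensor

noncomputable section

variable {A C : Type u} [Ring A] [AddCommGroup C] [Module A C] [Module Aᵐᵒᵖ C]
  [SMulCommClass A Aᵐᵒᵖ C] [Coring A C]

theorem coact_coassoc (M : ComoduleCat A C) (m : M) :
    assocHom A M C C (map M.coact LinearMap.id (M.coact m)) =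
      map LinearMap.id (Coring.comul (A := A) (C := C)).left (M.coact m) :=
  RightComodule.coassoc m

theorem counit_coact (M : ComoduleCat A C) (m : M) :
    rid A M (map LinearMap.id (Coring.counit (A := A) (C := C)).left (M.coact m)) = m :=
  RightComodule.counit_coact m

theorem coact_injective (M : ComoduleCat A C) : Function.Injective M.coact :=
  Function.LeftInverse.injective
    (g := fun x => rid A M (map LinearMap.id (Coring.counit (A := A) (C := C)).left x))
    M.counit_coact

/-! ### Construction of comodules: N ⊗_T S, quotients, kernels, and C itself -/

section intertwining

variable {X : Type*} [AddCommGroup X] [Module Aᵐᵒᵖ X] {M : ComoduleCat A C}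
  {ρ : X →ₗ[Aᵐᵒᵖ] NCTensor A X C}

/-- Coassociativity of a candidate coaction ρ is inherited on the image of any comodule that maps to
X compatibly with ρ. For N ⊗_T S the images of the maps u ↦ n ⊗ u span, and for a quotient the
projection is onto. -/
theorem coassoc_of_map_coact {i : M →ₗ[Aᵐᵒᵖ] X}
    (h : ∀ m, ρ (i m) = map i LinearMap.id (M.coact m)) (m : M) :
    assocHom A X C C (map ρ LinearMap.id (ρ (i m))) =
      map LinearMap.id (Coring.comul (A := A) (C := C)).left (ρ (i m)) := by
  have hi : ρ ∘ₗ i = mapRight i ∘ₗ M.coact := LinearMap.ext h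
  rw [h, map_map, hi, ← map_map (g := LinearMap.id) (g' := LinearMap.id), assocHom_map,
    coact_coassoc, map_map, map_map]
  rfl

theorem counit_of_map_coact {i : M →ₗ[Aᵐᵒᵖ] X}
    (h : ∀ m, ρ (i m) = map i LinearMap.id (M.coact m)) (m : M) :
    rid A X (map LinearMap.id (Coring.counit (A := A) (C := C)).left (ρ (i m))) = i m := by
  conv_rhs => rw [← M.counit_coact m, ← rid_map, map_map]
  rw [h, map_map]
  rfl

end intertwining

section tensor

variable (S : ComoduleCat A C) (N : Type u) [AddCommGroup N] [Module (End S)ᵐᵒᵖ N]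

/-- The coaction `n ⊗ u ↦ (n ⊗ u_[0]) ⊗ u_[1]`, as an additive map. -/
def tensorCoactHom : NCTensor (End S) N S →+ NCTensor A (NCTensor (End S) N S) C :=
  lift
    (AddMonoidHom.mk'
      (fun n => (map (mkRight (R := A) S n) LinearMap.id).comp S.coact.toAddMonoidHom)
      (fun n n' => by
        ext u
        simp only [AddMonoidHom.comp_apply, AddMonoidHom.add_apply]
        generalize S.coact.toAddMonoidHom u = x
        induction x using NCTensor.induction_on with
        | zero => simp
        | tmul m c => simp [add_tmul]
        | add x y hx hy => simp only [map_add, hx, hy]; abel))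
    (fun f n u => by
      simp only [AddMonoidHom.mk'_apply, AddMonoidHom.comp_apply, LinearMap.toAddMonoidHom_coe,
        end_smul_def, lin_colinear]
      rw [map_map, LinearMap.comp_id]
      congr 2
      ext u
      exact NCTensor.smul_tmul f n u)

theorem tensorCoactHom_tmul (n : N) (u : S) :
    tensorCoactHom S N (tmul (End S) n u) = map (mkRight (R := A) S n) LinearMap.id (S.coact u) :=
  rfl

/-- The coaction `n ⊗ u ↦ (n ⊗ u_[0]) ⊗ u_[1]` on `N ⊗_T S`, for `T = End^C(S)`. -/
def tensorCoact : NCTensor (End S) N S →ₗ[Aᵐᵒᵖ] NCTensor A (NCTensor (End S) N S) C where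
  toFun := tensorCoactHom S N
  map_add' := map_add _
  map_smul' a x := by
    induction x using NCTensor.induction_on with
    | zero => simp
    | tmul n u =>
      rw [op_smul_tmul, tensorCoactHom_tmul, tensorCoactHom_tmul, map_smul]
      exact map_smul (mapRight (R := A) (mkRight (R := A) S n)) a (S.coact u)
    | add x y hx hy => simp only [RingHom.id_apply, map_add, smul_add] at *; rw [hx, hy]

theorem tensorCoact_mkRight (n : N) (u : S) :
    tensorCoact S N (mkRight (R := A) S n u) =
      map (mkRight (R := A) S n) LinearMap.id (S.coact u) := rfl

instance tensorRightComodule : RightComodule A C (NCTensor (End S) N S) where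
  coact := tensorCoact S N
  coassoc x := by
    induction x using NCTensor.induction_on with
    | zero => simp
    | tmul n u => exact coassoc_of_map_coact (tensorCoact_mkRight S N n) u
    | add x y hx hy => simp only [map_add, hx, hy]
  counit_coact x := by
    induction x using NCTensor.induction_on with
    | zero => simp
    | tmul n u => exact counit_of_map_coact (tensorCoact_mkRight S N n) u
    | add x y hx hy => simp only [map_add, hx, hy]

/-- The comodule `N ⊗_T S`, for `T = End^C(S)` and a right `T`-module `N`. -/
def tensorObj : ComoduleCat A C := ⟨NCTensor (End S) N S⟩

variable {N}

/-- The colinear map `u ↦ n ⊗ u`. -/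
def toTensor (n : N) : S ⟶ tensorObj S N :=
  ⟨mkRight (R := A) S n, tensorCoact_mkRight S N n⟩

@[simp]
theorem toTensor_lin_apply (n : N) (u : S) : Hom.lin (toTensor S n) u = tmul (End S) n u := rfl

variable (N) in
/-- The unit `N → Hom^C(S, N ⊗_T S)`. -/
def tensorUnit : N →ₗ[(End S)ᵐᵒᵖ] (S ⟶ tensorObj S N) where
  toFun := toTensor S
  map_add' n n' := hom_ext fun u => NCTensor.add_tmul n n' u
  map_smul' f n := hom_ext fun u => NCTensor.smul_tmul f.unop n u

variable {S} {M : ComoduleCat A C}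

/-- The additive map `N ⊗_T S → M`, `n ⊗ u ↦ t(n)(u)`. -/
def tensorDescHom (t : N →ₗ[(End S)ᵐᵒᵖ] (S ⟶ M)) : NCTensor (End S) N S →+ M :=
  (ev S M).comp (map t LinearMap.id)

@[simp]
theorem tensorDescHom_tmul (t : N →ₗ[(End S)ᵐᵒᵖ] (S ⟶ M)) (n : N) (u : S) :
    tensorDescHom t (tmul (End S) n u) = Hom.lin (t n) u := rfl

/-- The right linear map `N ⊗_T S → M`, `n ⊗ u ↦ t(n)(u)`. -/
def tensorDescLin (t : N →ₗ[(End S)ᵐᵒᵖ] (S ⟶ M)) : NCTensor (End S) N S →ₗ[Aᵐᵒᵖ] M where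
  toFun := tensorDescHom t
  map_add' := map_add _
  map_smul' a x := by
    induction x using NCTensor.induction_on with
    | zero => simp
    | tmul n u => simp
    | add x y hx hy => simp only [RingHom.id_apply, map_add, smul_add] at *; rw [hx, hy]

/-- The colinear map `N ⊗_T S → M`, `n ⊗ u ↦ t(n)(u)`. -/
def tensorDesc (t : N →ₗ[(End S)ᵐᵒᵖ] (S ⟶ M)) : tensorObj S N ⟶ M :=
  ⟨tensorDescLin t, fun x => by
    change M.coact (tensorDescLin t x) = map (tensorDescLin t) LinearMap.id (tensorCoact S N x)
    induction x using NCTensor.induction_on with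
    | zero => simp
    | tmul n u =>
      refine (lin_colinear (t n) u).trans ?_
      refine Eq.trans ?_ (congrArg _ (tensorCoact_mkRight S N n u)).symm
      rw [map_map]
      rfl
    | add x y hx hy => simp only [map_add, hx, hy]⟩

theorem toTensor_tensorDesc (t : N →ₗ[(End S)ᵐᵒᵖ] (S ⟶ M)) (n : N) :
    toTensor S n ≫ tensorDesc t = t n := rfl

end tensor

section quotient

variable {M : ComoduleCat A C} (I : Submodule Aᵐᵒᵖ M)
  (hI : ∀ m ∈ I, map I.mkQ (LinearMap.id : C →ₗ[A] C) (M.coact m) = 0)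

/-- The coaction on the quotient by a subcomodule. -/
def quotientCoact : (M ⧸ I) →ₗ[Aᵐᵒᵖ] NCTensor A (M ⧸ I) C :=
  I.liftQ (mapRight I.mkQ ∘ₗ M.coact) hI

/-- The quotient of a comodule by a subcomodule. -/
def quotientObj : ComoduleCat A C :=
  { carrier := M ⧸ I
    comodule :=
      { coact := quotientCoact I hI
        coassoc := fun x => by
          obtain ⟨m, rfl⟩ := I.mkQ_surjective x
          exact coassoc_of_map_coact (i := I.mkQ) (ρ := quotientCoact I hI) (fun _ => rfl) m
        counit_coact := fun x => by
          obtain ⟨m, rfl⟩ := I.mkQ_surjective x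
          exact counit_of_map_coact (i := I.mkQ) (ρ := quotientCoact I hI) (fun _ => rfl) m } }

/-- The projection onto the quotient comodule. -/
def quotientMk : M ⟶ quotientObj I hI := ⟨I.mkQ, fun _ => rfl⟩

end quotient

section kernel

variable {M N : ComoduleCat A C} (g : M ⟶ N)

/-- By colinearity the coaction of an element of the kernel is killed by g ⊗ C, and flatness
identifies the kernel of g ⊗ C with (ker g) ⊗ C. -/
theorem exists_kerCoact (hC : IsFlatLeft A C) (k : LinearMap.ker (Hom.lin g)) :
    ∃ y, map (LinearMap.ker (Hom.lin g)).subtype (LinearMap.id : C →ₗ[A] C) y = M.coact k := by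
  apply exists_map_ker_subtype_of_flat hC
  rw [← lin_colinear, LinearMap.mem_ker.1 k.2, map_zero]

/-- The coaction on the kernel of a colinear map. -/
def kerCoactFun (hC : IsFlatLeft A C) (k : LinearMap.ker (Hom.lin g)) : NCTensor A (LinearMap.ker (Hom.lin g)) C :=
  (exists_kerCoact g hC k).choose

theorem map_subtype_kerCoactFun (hC : IsFlatLeft A C) (k : LinearMap.ker (Hom.lin g)) :
    map (LinearMap.ker (Hom.lin g)).subtype (LinearMap.id : C →ₗ[A] C) (kerCoactFun g hC k) =
      M.coact k :=
  (exists_kerCoact g hC k).choose_spec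

theorem map_ker_subtype_injective (hC : IsFlatLeft A C) :
    Function.Injective
      (map (LinearMap.ker (Hom.lin g)).subtype (LinearMap.id : C →ₗ[A] C)) :=
  hC _ _ _ (Submodule.injective_subtype _)

/-- The coaction on the kernel of a colinear map, as a linear map. -/
def kerCoact (hC : IsFlatLeft A C) :
    LinearMap.ker (Hom.lin g) →ₗ[Aᵐᵒᵖ] NCTensor A (LinearMap.ker (Hom.lin g)) C where
  toFun := kerCoactFun g hC
  map_add' k l := map_ker_subtype_injective g hC <| by
    simp only [map_add, map_subtype_kerCoactFun, Submodule.coe_add]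
  map_smul' a k := map_ker_subtype_injective g hC <| by
    rw [map_subtype_kerCoactFun, Submodule.coe_smul, map_smul, ← map_subtype_kerCoactFun g hC]
    exact (map_smul (mapRight (R := A) (LinearMap.ker (Hom.lin g)).subtype) a _).symm

theorem map_subtype_kerCoact (hC : IsFlatLeft A C) (k : LinearMap.ker (Hom.lin g)) :
    map (LinearMap.ker (Hom.lin g)).subtype (LinearMap.id : C →ₗ[A] C) (kerCoact g hC k) =
      M.coact k :=
  map_subtype_kerCoactFun g hC k

/-- The kernel of a colinear map, for `C` flat as a left `A`-module. -/
def kerObj (hC : IsFlatLeft A C) : ComoduleCat A C :=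
  { carrier := LinearMap.ker (Hom.lin g)
    comodule :=
      { coact := kerCoact g hC
        coassoc := fun k => by
          set ι := (LinearMap.ker (Hom.lin g)).subtype with hι
          -- Coassociativity can be checked in M ⊗ (C ⊗ C): after reassociation, flatness of C
          -- applied twice keeps the inclusion of the kernel injective.
          have hinj : Function.Injective
              (map ι (LinearMap.id : NCTensor A C C →ₗ[A] NCTensor A C C)) := by
            intro x y hxy
            obtain ⟨x, rfl⟩ := assocHom_surjective x
            obtain ⟨y, rfl⟩ := assocHom_surjective y
            rw [← assocHom_map, ← assocHom_map] at hxy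
            exact congrArg _ (hC _ _ (mapRight (R := A) ι) (map_ker_subtype_injective g hC)
              (assocHom_injective hxy))
          have hc : mapRight (R := A) ι ∘ₗ kerCoact g hC = M.coact ∘ₗ ι :=
            LinearMap.ext (map_subtype_kerCoact g hC)
          apply hinj
          rw [← assocHom_map, map_map, hc, ← map_map (g := LinearMap.id) (g' := LinearMap.id),
            map_subtype_kerCoact, coact_coassoc, ← map_subtype_kerCoact _ hC, map_map, map_map]
          rfl
        counit_coact := fun k => by
          apply Submodule.injective_subtype
          rw [← rid_map, map_map]
          conv_rhs => rw [Submodule.subtype_apply, ← M.counit_coact k,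
            ← map_subtype_kerCoact _ hC, map_map]
          rfl } }

/-- The inclusion of the kernel. -/
def kerι (hC : IsFlatLeft A C) : kerObj g hC ⟶ M :=
  ⟨(LinearMap.ker (Hom.lin g)).subtype, fun k => (map_subtype_kerCoact g hC k).symm⟩

theorem kerι_comp (hC : IsFlatLeft A C) : kerι g hC ≫ g = 0 := hom_ext fun k => LinearMap.mem_ker.1 k.2

theorem exists_kerι_apply (hC : IsFlatLeft A C) {m : M} (hm : Hom.lin g m = 0) :
    ∃ k : kerObj g hC, Hom.lin (kerι g hC) k = m := ⟨⟨m, hm⟩, rfl⟩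

end kernel

section regular

variable (A C) in
/-- The coring as a right comodule over itself. -/
def regular : ComoduleCat A C :=
  { carrier := C
    comodule :=
      { coact := (Coring.comul (A := A) (C := C)).right
        coassoc := Coring.coassoc
        counit_coact := Coring.comul_counit } }

end regular

variable (S : ComoduleCat A C)

/-! ### The isomorphism Hom_A(S, X) ⊗_T S ≅ X ⊗_A C in the Galois case -/

section homModule

variable (X Y : Type u) [AddCommGroup X] [Module Aᵐᵒᵖ X] [AddCommGroup Y] [Module Aᵐᵒᵖ Y]

/-- The right `A`-linear maps from `S` to `X` form a right module over `End^C(S)`. -/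
instance (priority := low) : Module (End S)ᵐᵒᵖ (S →ₗ[Aᵐᵒᵖ] X) where
  smul f g := g.comp (Hom.lin f.unop)
  one_smul _ := rfl
  mul_smul _ _ _ := rfl
  smul_zero _ := rfl
  smul_add _ _ _ := rfl
  add_smul f f' g := LinearMap.ext fun u => g.map_add (Hom.lin f.unop u) (Hom.lin f'.unop u)
  zero_smul g := LinearMap.ext fun _ => g.map_zero

theorem op_end_smul_linearMap (f : (End S)ᵐᵒᵖ) (g : S →ₗ[Aᵐᵒᵖ] X) :
    f • g = g ∘ₗ Hom.lin f.unop := rfl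

/-- The map `Hom_A(S, X) ⊗_T S → X ⊗_A C`, `f ⊗ u ↦ f(u_[0]) ⊗ u_[1]`. -/
def linCoact : NCTensor (End S) (S →ₗ[Aᵐᵒᵖ] X) S →+ NCTensor A X C :=
  lift
    (AddMonoidHom.mk'
      (fun f => (map f LinearMap.id).comp S.coact.toAddMonoidHom)
      (fun f f' => by
        ext u
        simp only [AddMonoidHom.comp_apply, AddMonoidHom.add_apply]
        generalize S.coact.toAddMonoidHom u = x
        induction x using NCTensor.induction_on with
        | zero => simp
        | tmul m c => simp [add_tmul]
        | add x y hx hy => simp only [map_add, hx, hy]; abel))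
    (fun b f u => by
      simp only [AddMonoidHom.mk'_apply, AddMonoidHom.comp_apply, LinearMap.toAddMonoidHom_coe,
        end_smul_def, lin_colinear, map_map, LinearMap.comp_id]
      rfl)

@[simp]
theorem linCoact_tmul (f : S →ₗ[Aᵐᵒᵖ] X) (u : S) :
    linCoact S X (tmul (End S) f u) = map f LinearMap.id (S.coact u) := rfl

variable {X Y} in
/-- Composition with a right linear map, as a map of right modules over `End^C(S)`. -/
def postcomp (i : X →ₗ[Aᵐᵒᵖ] Y) : (S →ₗ[Aᵐᵒᵖ] X) →ₗ[(End S)ᵐᵒᵖ] (S →ₗ[Aᵐᵒᵖ] Y) where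
  toFun f := i ∘ₗ f
  map_add' f g := LinearMap.comp_add f g i
  map_smul' _ _ := rfl

variable {X Y} in
theorem linCoact_map_postcomp (i : X →ₗ[Aᵐᵒᵖ] Y) (z : NCTensor (End S) (S →ₗ[Aᵐᵒᵖ] X) S) :
    linCoact S Y (map (postcomp S i) LinearMap.id z) = map i LinearMap.id (linCoact S X z) := by
  induction z using NCTensor.induction_on with
  | zero => simp
  | tmul f u => rw [linCoact_tmul, map_map]; rfl
  | add x y hx hy => simp only [map_add, hx, hy]

variable {X} in
/-- The map `S* → Hom_A(S, X)`, `g ↦ x g(-)`. -/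
def dualToLin (x : X) : Dual S →ₗ[(End S)ᵐᵒᵖ] (S →ₗ[Aᵐᵒᵖ] X) where
  toFun g :=
    { toFun := fun u => op (g u) • x
      map_add' := fun u v => by simp [add_smul]
      map_smul' := fun a u => by simp [mul_smul] }
  map_add' g h := LinearMap.ext fun u => add_smul (op (g u)) (op (h u)) x
  map_smul' _ _ := rfl

variable {X} in
theorem dualToLin_apply (x : X) (g : Dual S) (u : S) : dualToLin S x g u = op (g u) • x := rfl

/-- The map `X ⊗_A (S* ⊗_T S) → Hom_A(S, X) ⊗_T S`, `x ⊗ (g ⊗ u) ↦ x g(-) ⊗ u`. -/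
def comatrixToLin :
    NCTensor A X (NCTensor (End S) (Dual S) S) →+ NCTensor (End S) (S →ₗ[Aᵐᵒᵖ] X) S :=
  lift
    (AddMonoidHom.mk' (fun x => map (dualToLin S x) LinearMap.id) fun x y =>
      NCTensor.hom_ext fun g u => by
        rw [AddMonoidHom.add_apply, map_tmul, map_tmul, map_tmul, ← add_tmul]
        congr 1
        exact LinearMap.ext fun v => smul_add _ _ _)
    (fun a x y => by
      induction y using NCTensor.induction_on with
      | zero => simp
      | tmul g u =>
        rw [left_smul_tmul, AddMonoidHom.mk'_apply, map_tmul, map_tmul]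
        congr 1
        exact LinearMap.ext fun v => (mul_smul (op (g v)) (op a) x).symm
      | add x y hx hy => rw [smul_add, map_add, map_add, hx, hy])

@[simp]
theorem comatrixToLin_tmul (x : X) (g : Dual S) (u : S) :
    comatrixToLin S X (tmul A x (tmul (End S) g u)) = tmul (End S) (dualToLin S x g) u := rfl

/-- Relates `linCoact` at an arbitrary X to X ⊗ `can`, so that the Galois condition gives
information about all right A-modules. -/
theorem linCoact_comatrixToLin (z : NCTensor A X (NCTensor (End S) (Dual S) S)) :
    linCoact S X (comatrixToLin S X z) = map LinearMap.id (can S).left z := by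
  induction z using NCTensor.induction_on with
  | zero => simp
  | tmul x y =>
    induction y using NCTensor.induction_on with
    | zero => simp [NCTensor.tmul_zero]
    | tmul g u =>
      rw [comatrixToLin_tmul, linCoact_tmul, map_tmul]
      change _ = tmul A x (canAux S g u)
      rw [canAux_apply]
      generalize S.coact u = y
      induction y using NCTensor.induction_on with
      | zero => simp [NCTensor.tmul_zero]
      | tmul v c => simp [dualToLin_apply, NCTensor.smul_tmul]
      | add x y hx hy => simp only [map_add, NCTensor.tmul_add, hx, hy]
    | add x y hx hy => simp only [map_add, NCTensor.tmul_add, hx, hy]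
  | add x y hx hy => simp only [map_add, hx, hy]

theorem exists_dual_basis (P : Type*) [AddCommGroup P] [Module Aᵐᵒᵖ P] [Module.Finite Aᵐᵒᵖ P]
    [Module.Projective Aᵐᵒᵖ P] :
    ∃ (n : ℕ) (e : Fin n → P) (d : Fin n → (P →ₗ[Aᵐᵒᵖ] A)),
      ∀ p : P, ∑ i, op (d i p) • e i = p := by
  obtain ⟨n, f, g, -, -, h⟩ := Module.Finite.exists_comp_eq_id_of_projective Aᵐᵒᵖ P
  refine ⟨n, fun i => f (Pi.single i 1), fun i =>
    { toFun := fun p => unop (g p i)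
      map_add' := fun p q => by simp
      map_smul' := fun a p => by simp }, fun p => ?_⟩
  conv_rhs => rw [← LinearMap.id_apply (R := Aᵐᵒᵖ) p, ← h, LinearMap.comp_apply,
    pi_eq_sum_univ' (g p), map_sum]
  refine Finset.sum_congr rfl fun i _ => ?_
  rw [map_smul]
  rfl

theorem comatrixToLin_surjective [Module.Finite Aᵐᵒᵖ S] [Module.Projective Aᵐᵒᵖ S] :
    Function.Surjective (comatrixToLin S X) := by
  obtain ⟨n, e, d, h⟩ := exists_dual_basis (A := A) S
  intro z
  induction z using NCTensor.induction_on with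
  | zero => exact ⟨0, map_zero _⟩
  | tmul f u =>
    -- The dual basis gives f = ∑ f(e_i) d_i(-), hence f ⊗ u is the image of this sum.
    refine ⟨∑ i, tmul A (f (e i)) (tmul (End S) (d i) u), ?_⟩
    rw [map_sum]
    simp only [comatrixToLin_tmul]
    rw [← sum_tmul]
    congr 1
    ext v
    conv_rhs => rw [← h v, map_sum]
    simp [dualToLin_apply]
  | add x y hx hy =>
    obtain ⟨x, rfl⟩ := hx
    obtain ⟨y, rfl⟩ := hy
    exact ⟨x + y, map_add _ _ _⟩

variable {S} in
-- The composite with the surjection `comatrixToLin` is X ⊗ `can`, which is bijective. A surjection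
-- followed by a map with bijective composite forces both to be bijective.
theorem IsGalois.linCoact_bijective [Module.Finite Aᵐᵒᵖ S] [Module.Projective Aᵐᵒᵖ S]
    (hS : IsGalois S) : Function.Bijective (linCoact S X) := by
  have hb : Function.Bijective (linCoact S X ∘ comatrixToLin S X) := by
    convert map_id_bijective (M := X) hS
    exact funext fun z => linCoact_comatrixToLin S X z
  refine ⟨fun x y hxy => ?_, hb.2.of_comp⟩
  obtain ⟨x, rfl⟩ := comatrixToLin_surjective S X x
  obtain ⟨y, rfl⟩ := comatrixToLin_surjective S X y
  exact congrArg _ (hb.1 hxy)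

end homModule

section galois

variable {S} [Module.Finite Aᵐᵒᵖ S] [Module.Projective Aᵐᵒᵖ S]

/-- Through `linCoact` the functor - ⊗_A C becomes Hom_A(S, -) followed by - ⊗_T S, and both of
these preserve injections. -/
theorem IsGalois.isFlatLeft (hS : IsGalois S) (hB : IsFlatLeft (End S) S) : IsFlatLeft A C := by
  intro N N' _ _ _ _ i hi x y hxy
  obtain ⟨x, rfl⟩ := (hS.linCoact_bijective N).2 x
  obtain ⟨y, rfl⟩ := (hS.linCoact_bijective N).2 y
  rw [← linCoact_map_postcomp, ← linCoact_map_postcomp] at hxy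
  refine congrArg _ (hB _ _ (postcomp S i) (fun f g hfg => ?_) ((hS.linCoact_bijective N').1 hxy))
  exact LinearMap.ext fun u => hi (LinearMap.congr_fun hfg u)

end galois

/-! ### Colinear maps as a kernel: Galois and flat imply that `ev` is bijective -/

section equalizer

variable (M : ComoduleCat A C)

/-- The inclusion of the colinear maps into the linear maps. -/
def homToLin : (S ⟶ M) →ₗ[(End S)ᵐᵒᵖ] (S →ₗ[Aᵐᵒᵖ] M) where
  toFun := Hom.lin
  map_add' _ _ := rfl
  map_smul' _ _ := rfl

theorem homToLin_injective : Function.Injective (homToLin S M) := Subtype.val_injective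

theorem linCoact_map_homToLin (z : NCTensor (End S) (S ⟶ M) S) :
    linCoact S M (map (homToLin S M) LinearMap.id z) = M.coact (ev S M z) := by
  induction z using NCTensor.induction_on with
  | zero => simp
  | tmul f u => exact (lin_colinear f u).symm
  | add x y hx hy => simp only [map_add, hx, hy]

/-- The defect of colinearity: `f ↦ ρ_M ∘ f - (f ⊗ C) ∘ ρ_S`. -/
def colinearDefect :
    (S →ₗ[Aᵐᵒᵖ] M) →ₗ[(End S)ᵐᵒᵖ] (S →ₗ[Aᵐᵒᵖ] NCTensor A M C) where
  toFun f := M.coact ∘ₗ f - mapRight f ∘ₗ S.coact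
  map_add' f g := by
    have h : mapRight (R := A) (N := C) (f + g) = mapRight f + mapRight g :=
      LinearMap.ext fun x => DFunLike.congr_fun
        (show map (f + g) (LinearMap.id : C →ₗ[A] C) =
            map f LinearMap.id + map g LinearMap.id from
          NCTensor.hom_ext fun m c => by simp [add_tmul]) x
    rw [h, LinearMap.comp_add, LinearMap.add_comp]
    abel
  map_smul' b f := by
    ext u
    simp [op_end_smul_linearMap, lin_colinear, map_map]

theorem colinearDefect_apply (f : S →ₗ[Aᵐᵒᵖ] M) :
    colinearDefect S M f = M.coact ∘ₗ f - mapRight f ∘ₗ S.coact := rfl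

/-- Under `linCoact` the defect of colinearity, tensored with S, becomes the defect of
coassociativity on M ⊗ C, which vanishes on the image of the coaction of M. -/
theorem assocHom_linCoact_colinearDefect (z : NCTensor (End S) (S →ₗ[Aᵐᵒᵖ] M) S) :
    assocHom A M C C
        (linCoact S (NCTensor A M C) (map (colinearDefect S M) LinearMap.id z)) =
      assocHom A M C C (map M.coact LinearMap.id (linCoact S M z)) -
        map LinearMap.id (Coring.comul (A := A) (C := C)).left (linCoact S M z) := by
  induction z using NCTensor.induction_on with
  | zero => simp
  | tmul f u =>
    rw [map_tmul, linCoact_tmul, linCoact_tmul, colinearDefect_apply, map_sub_left, map_sub,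
      ← LinearMap.comp_id LinearMap.id, ← map_map, ← map_map, assocHom_map]
    congr 1
    rw [LinearMap.id_apply, coact_coassoc, map_map, LinearMap.comp_id, map_map]
    rfl
  | add x y hx hy => simp only [map_add, hx, hy]; abel

/-- The kernel of the defect of colinearity consists of colinear maps. -/
def kerDefectToHom :
    LinearMap.ker (colinearDefect S M) →ₗ[(End S)ᵐᵒᵖ] (S ⟶ M) where
  toFun f := ⟨f.1, fun u => sub_eq_zero.1 (LinearMap.congr_fun (LinearMap.mem_ker.1 f.2) u)⟩
  map_add' _ _ := rfl
  map_smul' _ _ := rfl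

theorem homToLin_comp_kerDefectToHom :
    homToLin S M ∘ₗ kerDefectToHom S M = (LinearMap.ker (colinearDefect S M)).subtype := rfl

variable {S} in
theorem IsGalois.ev_bijective [Module.Finite Aᵐᵒᵖ S] [Module.Projective Aᵐᵒᵖ S]
    (hS : IsGalois S) (hB : IsFlatLeft (End S) S) : Function.Bijective (ev S M) := by
  constructor
  · intro x y hxy
    have h := congrArg M.coact hxy
    rw [← linCoact_map_homToLin, ← linCoact_map_homToLin] at h
    exact hB _ _ _ (homToLin_injective S M) ((hS.linCoact_bijective M).1 h)
  · intro m
    obtain ⟨z, hz⟩ := (hS.linCoact_bijective M).2 (M.coact m)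
    -- The preimage z of ρ(m) is killed by the defect because ρ is coassociative. Flatness then
    -- lifts z to Hom^C(S, M) ⊗_T S, and injectivity of ρ shows that the lift evaluates to m.
    have h0 : map (colinearDefect S M) LinearMap.id z = 0 := by
      apply (hS.linCoact_bijective (NCTensor A M C)).1
      apply assocHom_injective
      rw [assocHom_linCoact_colinearDefect, hz, coact_coassoc, sub_self, map_zero, map_zero]
    obtain ⟨y, hy⟩ := exists_map_ker_subtype_of_flat hB _ h0
    refine ⟨map (kerDefectToHom S M) LinearMap.id y, M.coact_injective ?_⟩
    rw [← linCoact_map_homToLin, map_map, homToLin_comp_kerDefectToHom, LinearMap.comp_id, hy, hz]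

end equalizer

/-! ### Hom^C(S, C) ≅ S*, and `can` as an evaluation map -/

section regular

/-- For `g` in `S*`, the colinear map `S → C`, `u ↦ g(u_[0]) u_[1]`. -/
def dualToRegular (g : Dual S) : S ⟶ regular A C :=
  ⟨{ toFun := canAux S g
     map_add' := map_add _
     map_smul' := fun a u => canAux_op_smul S a g u }, fun u => by
    change (Coring.comul (A := A) (C := C)).left (canAux S g u) = _
    -- The linear map on the right is the contraction s ⊗ c ↦ g(s) c, whose composite with the
    -- coaction of S is `canAux S g`. Contracting coassociativity of S with g thus gives
    -- colinearity.
    have h : ∀ y : NCTensor A (NCTensor A S C) C,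
        lid A (NCTensor A C C) (map g LinearMap.id (assocHom A S C C y)) =
          map (A := A) (N := C)
            ({ toFun := fun x => lid A C (map g LinearMap.id x)
               map_add' := fun x y => by simp
               map_smul' := fun a x => by
                 induction x using NCTensor.induction_on with
                 | zero => simp
                 | tmul m c => simp [smul_comm]
                 | add x y hx hy =>
                  simp only [map_add, smul_add, RingHom.id_apply] at *; rw [hx, hy] } :
              NCTensor A S C →ₗ[Aᵐᵒᵖ] C) LinearMap.id y := by
      intro y
      induction y using NCTensor.induction_on with
      | zero => simp
      | tmul x d =>
        induction x using NCTensor.induction_on with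
        | zero => simp [NCTensor.zero_tmul]
        | tmul s c => simp
        | add x y hx hy => simp only [map_add, NCTensor.add_tmul, hx, hy]
      | add x y hx hy => simp only [map_add, hx, hy]
    rw [canAux_apply, ← lid_map, map_map, LinearMap.id_comp, LinearMap.comp_id]
    have h2 := congrArg (fun x => lid A (NCTensor A C C) (map g LinearMap.id x))
      (S.coact_coassoc u)
    simp only [h, map_map, LinearMap.comp_id, LinearMap.id_comp] at h2
    exact h2.symm⟩

theorem dualToRegular_lin_apply (g : Dual S) (u : S) :
    Hom.lin (dualToRegular S g) u = canAux S g u := rfl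

/-- `S* → Hom^C(S, C)` as a map of right modules over `End^C(S)`. -/
def dualToRegularLin : Dual S →ₗ[(End S)ᵐᵒᵖ] (S ⟶ regular A C) where
  toFun := dualToRegular S
  map_add' g h := hom_ext fun u => DFunLike.congr_fun (canAux_add S g h) u
  map_smul' f g := hom_ext fun u => canAux_balanced S f.unop g u

theorem counit_canAux (g : Dual S) (u : S) :
    (Coring.counit (A := A) (C := C)).left (canAux S g u) = g u := by
  conv_rhs => rw [← S.counit_coact u]
  rw [canAux_apply]
  generalize S.coact u = x
  induction x using NCTensor.induction_on with
  | zero => simp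
  | tmul m c => simp
  | add x y hx hy => simp only [map_add, hx, hy]

theorem dualToRegularLin_bijective : Function.Bijective (dualToRegularLin S) := by
  constructor
  · intro g h hgh
    ext u
    rw [← counit_canAux, ← counit_canAux, ← dualToRegular_lin_apply, ← dualToRegular_lin_apply]
    exact congrArg (fun f => (Coring.counit (A := A) (C := C)).left (Hom.lin f u)) hgh
  · intro f
    -- The inverse is f ↦ ε ∘ f; colinearity of f and the left counit law recover f from it.
    refine ⟨(Coring.counit (A := A) (C := C)).right ∘ₗ Hom.lin f, hom_ext fun u => ?_⟩
    have h := Coring.counit_comul (A := A) (C := C) (Hom.lin f u)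
    change canAux S _ u = _
    rw [canAux_apply]
    refine Eq.trans ?_ h
    congr 1
    refine Eq.trans ?_ (congrArg _ (lin_colinear f u)).symm
    exact (map_map (M' := C) (Hom.lin f) LinearMap.id (Coring.counit (A := A) (C := C)).right
      LinearMap.id (S.coact u)).symm

theorem can_eq_ev (x : NCTensor (End S) (Dual S) S) :
    (can S).left x = ev S (regular A C) (map (dualToRegularLin S) LinearMap.id x) := by
  induction x using NCTensor.induction_on with
  | zero => simp only [map_zero]; rfl
  | tmul f u => rfl
  | add x y hx hy => simp only [map_add, hx, hy]; rfl

theorem isGalois_of_ev_bijective (h : Function.Bijective (ev S (regular A C))) : IsGalois S := by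
  have := h.comp (map_bijective (N := S) (dualToRegularLin_bijective S))
  rwa [IsGalois, show ((can S).left : _ → C) = _ from funext (can_eq_ev S)]

end regular

variable {S}

/-! ### Full faithfulness of Hom^C(S, -) and bijectivity of `ev` -/

section fullyFaithful

theorem tensorDescLin_id (M : ComoduleCat A C) :
    ⇑(tensorDescLin (LinearMap.id : (S ⟶ M) →ₗ[(End S)ᵐᵒᵖ] (S ⟶ M))) = ev S M :=
  funext fun x => congrArg (ev S M) (map_id_id x)

theorem homFunctor_faithful (h : ∀ M : ComoduleCat A C, Function.Surjective (ev S M)) :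
    S.homFunctor.Faithful where
  map_injective {M N} g g' hg := hom_ext fun m => by
    obtain ⟨x, rfl⟩ := h M m
    induction x using NCTensor.induction_on with
    | zero => simp
    | tmul f u =>
      have hf : f ≫ g = f ≫ g' := LinearMap.congr_fun (congrArg ModuleCat.Hom.hom hg) f
      exact LinearMap.congr_fun (congrArg Hom.lin hf) u
    | add x y hx hy => simp only [map_add, hx, hy]

theorem homFunctor_full (h : ∀ M : ComoduleCat A C, Function.Bijective (ev S M)) :
    S.homFunctor.Full where
  map_surjective {M N} t := by
    let e := tensorDesc (LinearMap.id : (S ⟶ M) →ₗ[(End S)ᵐᵒᵖ] (S ⟶ M))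
    have he : Function.Bijective (Hom.lin e) := by
      have hM := h M
      rw [← tensorDescLin_id] at hM
      exact hM
    let t' : (S ⟶ M) →ₗ[(End S)ᵐᵒᵖ] (S ⟶ N) := t.hom
    let E := LinearEquiv.ofBijective (Hom.lin e) he
    let l : M →ₗ[Aᵐᵒᵖ] N := Hom.lin (tensorDesc t') ∘ₗ E.symm.toLinearMap
    have hl : ∀ x, l (Hom.lin e x) = Hom.lin (tensorDesc t') x := fun x =>
      congrArg (Hom.lin (tensorDesc t')) (E.symm_apply_apply x)
    -- The inverse of `ev` followed by the map induced by t; colinearity is checked on elements of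
    -- the form e(x), where it follows from that of e and of the induced map.
    let g : M ⟶ N := ⟨l, fun m => by
      obtain ⟨x, rfl⟩ := he.2 m
      rw [hl, lin_colinear, lin_colinear, map_map]
      congr 2
      exact LinearMap.ext fun x => (hl x).symm⟩
    refine ⟨g, ?_⟩
    apply ModuleCat.hom_ext
    refine LinearMap.ext fun f => hom_ext fun u => ?_
    exact hl (tmul (End S) f u : NCTensor (End S) (S ⟶ M) S)

theorem ev_bijective_of_full_faithful [S.homFunctor.Full] [S.homFunctor.Faithful]
    (M : ComoduleCat A C) : Function.Bijective (ev S M) := by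
  let e := tensorDesc (LinearMap.id : (S ⟶ M) →ₗ[(End S)ᵐᵒᵖ] (S ⟶ M))
  -- Fullness realises the unit at Hom^C(S, M) by a morphism s from M to Hom^C(S, M) ⊗_T S. It is
  -- the inverse of `ev`: one composite is the identity by the triangle identity and faithfulness,
  -- the other by evaluation on pure tensors.
  obtain ⟨s, hs⟩ := S.homFunctor.map_surjective
    (X := M) (Y := tensorObj S (S ⟶ M)) (ModuleCat.ofHom (tensorUnit S (S ⟶ M)))
  have hs' : ∀ f : S ⟶ M, f ≫ s = toTensor S f := fun f =>
    LinearMap.congr_fun (congrArg ModuleCat.Hom.hom hs) f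
  have h1 : s ≫ e = 𝟙 M := by
    apply S.homFunctor.map_injective
    apply ModuleCat.hom_ext
    refine LinearMap.ext fun f => ?_
    change f ≫ (s ≫ e) = f ≫ 𝟙 M
    exact (Category.assoc f s e).symm.trans
      ((congrArg (· ≫ e) (hs' f)).trans (Category.comp_id _).symm)
  constructor
  · refine Function.LeftInverse.injective (g := Hom.lin s) fun x => ?_
    induction x using NCTensor.induction_on with
    | zero => simp only [map_zero]; rfl
    | tmul f u => exact LinearMap.congr_fun (congrArg Hom.lin (hs' f)) u
    | add x y hx hy => simp only [map_add, hx, hy]; rfl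
  · intro m
    refine ⟨(Hom.lin s m : NCTensor (End S) (S ⟶ M) S), ?_⟩
    refine (congrFun (tensorDescLin_id M) _).symm.trans ?_
    exact LinearMap.congr_fun (congrArg Hom.lin h1) m

end fullyFaithful

/-! ### Generators: surjectivity and injectivity of `ev`, and flatness of S -/

section generator

theorem isGenerator_of_ev_surjective
    (h : ∀ M : ComoduleCat A C, Function.Surjective (ev S M)) : IsGenerator S := by
  intro M N g hg
  by_contra! hf
  apply hg
  refine hom_ext fun m => ?_
  obtain ⟨x, rfl⟩ := h M m
  induction x using NCTensor.induction_on with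
  | zero => simp
  | tmul f u => exact LinearMap.congr_fun (congrArg Hom.lin (hf f)) u
  | add x y hx hy => simp only [map_add, hx, hy]

theorem IsGenerator.ev_surjective (hS : IsGenerator S) (M : ComoduleCat A C) :
    Function.Surjective (ev S M) := by
  let e := tensorDesc (LinearMap.id : (S ⟶ M) →ₗ[(End S)ᵐᵒᵖ] (S ⟶ M))
  let I : Submodule Aᵐᵒᵖ M := LinearMap.range (Hom.lin e)
  have hfI : ∀ (f : S ⟶ M), I.mkQ ∘ₗ Hom.lin f = 0 := fun f => LinearMap.ext fun u =>
    (Submodule.Quotient.mk_eq_zero I).2 ⟨(tmul (End S) f u : NCTensor (End S) (S ⟶ M) S), rfl⟩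
  have hI : ∀ m ∈ I, map I.mkQ (LinearMap.id : C →ₗ[A] C) (M.coact m) = 0 := by
    rintro _ ⟨x, rfl⟩
    have hx : ∀ x : NCTensor (End S) (S ⟶ M) S,
        map I.mkQ (LinearMap.id : C →ₗ[A] C) (M.coact (ev S M x)) = 0 := by
      intro x
      induction x using NCTensor.induction_on with
      | zero => simp
      | tmul f u => rw [ev_tmul, lin_colinear, map_map, hfI, map_zero_left]
      | add x y hx hy => simp only [map_add, hx, hy, add_zero]
    have := hx x
    rw [← tensorDescLin_id] at this
    exact this
  -- Every morphism from S to M lands in the image I of `ev`, so it dies in M / I; a generator then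
  -- forces the projection to vanish.
  have h0 : quotientMk I hI = 0 := by
    by_contra hne
    obtain ⟨f, hf⟩ := hS M _ _ hne
    exact hf (hom_ext fun u => LinearMap.congr_fun (hfI f) u)
  intro m
  have hm : I.mkQ m = 0 := LinearMap.congr_fun (congrArg Hom.lin h0) m
  obtain ⟨x, hx⟩ := (Submodule.Quotient.mk_eq_zero I).1 hm
  exact ⟨x, (congrFun (tensorDescLin_id M) x).symm.trans hx⟩

variable {N : Type u} [AddCommGroup N] [Module (End S)ᵐᵒᵖ N] {M : ComoduleCat A C}

/-- The `i`-th coordinate of `T^k`, as a map into `T = Hom^C(S, S)`. -/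
def freeCoord {k : ℕ} (i : Fin k) : (Fin k → (End S)ᵐᵒᵖ) →ₗ[(End S)ᵐᵒᵖ] (S ⟶ S) where
  toFun b := (b i).unop
  map_add' _ _ := rfl
  map_smul' _ _ := rfl

/-- The coordinates identify T^k ⊗_T S with S^k, so a colinear map S → T^k ⊗_T S is given by k
elements of T. -/
theorem sum_tmul_freeCoord {k : ℕ} (x : NCTensor (End S) (Fin k → (End S)ᵐᵒᵖ) S) :
    ∑ i, tmul (End S) (Pi.single i 1 : Fin k → (End S)ᵐᵒᵖ)
      (tensorDescLin (freeCoord (S := S) i) x) = x := by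
  induction x using NCTensor.induction_on with
  | zero => simp only [map_zero, NCTensor.tmul_zero, Finset.sum_const_zero]
  | tmul b u =>
    conv_rhs => rw [pi_eq_sum_univ' b, NCTensor.sum_tmul]
    refine Finset.sum_congr rfl fun i _ => ?_
    exact (NCTensor.smul_tmul (b i).unop _ u).symm
  | add x y hx hy =>
    conv_rhs => rw [← hx, ← hy, ← Finset.sum_add_distrib]
    refine Finset.sum_congr rfl fun i _ => ?_
    rw [map_add, NCTensor.tmul_add]

/-- A monomorphism `N → Hom^C(S, M)` induces a monomorphism `N ⊗_T S → M`. -/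
theorem IsGenerator.tensorDescLin_injective (hS : IsGenerator S) (hC : IsFlatLeft A C)
    (t : N →ₗ[(End S)ᵐᵒᵖ] (S ⟶ M)) (ht : Function.Injective t) :
    Function.Injective (tensorDescLin t) := by
  rw [injective_iff_map_eq_zero]
  intro x hx
  obtain ⟨k, n, u, hnu⟩ := exists_fin_sum x
  -- The finitely many n_i occurring in x define q : T^k → N, and x lifts along q ⊗ S to y. It
  -- suffices that q ⊗ S kills the kernel of the composite g : T^k ⊗_T S → M.
  let q : (Fin k → (End S)ᵐᵒᵖ) →ₗ[(End S)ᵐᵒᵖ] N := Fintype.linearCombination (End S)ᵐᵒᵖ n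
  have hq : ∀ i, q (Pi.single i 1) = n i := fun i => by
    simp [q, Fintype.linearCombination_apply_single]
  let y : NCTensor (End S) (Fin k → (End S)ᵐᵒᵖ) S :=
    ∑ i, tmul (End S) (Pi.single i 1) (u i)
  have hy : map q LinearMap.id y = x := by
    rw [map_sum]
    refine Eq.trans (Finset.sum_congr rfl fun i _ => ?_) hnu.symm
    rw [map_tmul, hq]; rfl
  let g := tensorDesc (t ∘ₗ q)
  have hg : ∀ z : NCTensor (End S) (Fin k → (End S)ᵐᵒᵖ) S,
      Hom.lin g z = tensorDescLin t (map q LinearMap.id z) := fun z =>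
    congrArg (ev S M) (map_map q LinearMap.id t LinearMap.id z).symm
  -- Each h has the form v ↦ b ⊗ v with b in T^k. If h followed by g is zero then t(q(b)) = 0, so
  -- q(b) = 0 by injectivity of t.
  have hzero : ∀ h : S ⟶ tensorObj S (Fin k → (End S)ᵐᵒᵖ), h ≫ g = 0 →
      ∀ v, map q LinearMap.id (Hom.lin h v : NCTensor (End S) (Fin k → (End S)ᵐᵒᵖ) S) = 0 := by
    intro h hh v
    let b : Fin k → (End S)ᵐᵒᵖ := fun i => op (h ≫ tensorDesc (freeCoord i))
    have hb : h = toTensor S b := hom_ext fun v => by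
      refine (sum_tmul_freeCoord (Hom.lin h v)).symm.trans ?_
      conv_rhs => rw [pi_eq_sum_univ' b, toTensor_lin_apply, NCTensor.sum_tmul]
      refine Finset.sum_congr rfl fun i _ => ?_
      exact (NCTensor.smul_tmul (b i).unop _ v).symm
    have hqb : q b = 0 := by
      apply ht
      rw [map_zero, ← hh, hb, toTensor_tensorDesc]
      rfl
    rw [hb, toTensor_lin_apply, map_tmul, hqb, NCTensor.zero_tmul]
  have hgy : Hom.lin g y = 0 := by rw [hg, hy, hx]
  obtain ⟨κ, hκ⟩ := exists_kerι_apply g hC hgy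
  -- The kernel of g is a comodule because C is flat, so the generator covers it: y is a sum of
  -- values of maps S → ker g, all killed by q ⊗ S.
  obtain ⟨w, rfl⟩ := hS.ev_surjective _ κ
  have hw : ∀ w : NCTensor (End S) (S ⟶ kerObj g hC) S,
      map q LinearMap.id (Hom.lin (kerι g hC) (ev S _ w) :
        NCTensor (End S) (Fin k → (End S)ᵐᵒᵖ) S) = 0 := by
    intro w
    induction w using NCTensor.induction_on with
    | zero => rw [map_zero, map_zero]; exact map_zero _
    | tmul f v =>
      exact hzero (f ≫ kerι g hC) (by rw [Category.assoc, kerι_comp, Limits.comp_zero]) v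
    | add x y hx hy =>
      rw [map_add, map_add]
      exact (map_add _ _ _).trans (by rw [hx, hy, add_zero])
  rw [← hy, ← hκ]
  exact hw w

theorem IsGenerator.ev_bijective (hS : IsGenerator S) (hC : IsFlatLeft A C)
    (M : ComoduleCat A C) : Function.Bijective (ev S M) := by
  refine ⟨?_, hS.ev_surjective M⟩
  rw [← tensorDescLin_id]
  exact hS.tensorDescLin_injective hC LinearMap.id Function.injective_id

/-- The inclusion of a right ideal of `T` into `T = Hom^C(S, S)`. -/
def idealToHom (I : Ideal (End S)ᵐᵒᵖ) : I →ₗ[(End S)ᵐᵒᵖ] (S ⟶ S) where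
  toFun b := b.1.unop
  map_add' _ _ := rfl
  map_smul' _ _ := rfl

theorem IsGenerator.isFlatLeft (hS : IsGenerator S) (hC : IsFlatLeft A C) :
    IsFlatLeft (End S) S := by
  refine isFlatLeft_of_idealMul_injective fun I => ?_
  have h : idealMul S I = tensorDescHom (idealToHom I) := NCTensor.hom_ext fun _ _ => rfl
  rw [h]
  exact hS.tensorDescLin_injective hC (idealToHom I) fun a b h => Subtype.ext (unop_injective h)

end generator

end

end ComoduleCat

theorem theorem3p8 {A C : Type u} [Ring A] [AddCommGroup C] [Module A C] [Module Aᵐᵒᵖ C]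
    [SMulCommClass A Aᵐᵒᵖ C] [Coring A C] (S : ComoduleCat A C)
    [Module.Finite Aᵐᵒᵖ S] [Module.Projective Aᵐᵒᵖ S] :
    List.TFAE [
      ComoduleCat.IsGalois S ∧ IsFlatLeft (End S) S,
      (S.homFunctor.Full ∧ S.homFunctor.Faithful) ∧ IsFlatLeft (End S) S,
      ComoduleCat.IsGenerator S ∧ IsFlatLeft A C,
      (∀ M : ComoduleCat A C, Function.Bijective (ComoduleCat.ev S M)) ∧
        IsFlatLeft (End S) S] := by
  tfae_have 1 → 4 := fun ⟨h, hB⟩ => ⟨fun M => h.ev_bijective M hB, hB⟩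
  tfae_have 4 → 1 := fun ⟨h, hB⟩ => ⟨S.isGalois_of_ev_bijective (h _), hB⟩
  tfae_have 4 → 2 := fun ⟨h, hB⟩ => ⟨⟨ComoduleCat.homFunctor_full h,
    ComoduleCat.homFunctor_faithful fun M => (h M).2⟩, hB⟩
  tfae_have 2 → 4 := fun ⟨⟨_, _⟩, hB⟩ => ⟨ComoduleCat.ev_bijective_of_full_faithful, hB⟩
  tfae_have 4 → 3 := fun ⟨h, hB⟩ => ⟨ComoduleCat.isGenerator_of_ev_surjective fun M => (h M).2,
    (S.isGalois_of_ev_bijective (h _)).isFlatLeft hB⟩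
  tfae_have 3 → 4 := fun ⟨h, hC⟩ => ⟨h.ev_bijective hC, h.isFlatLeft hC⟩
  tfae_finish
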